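/- Let $A$ be one of the real $*$-algebras $\mathbb{C},\mathbb{H},\mathbb{O}$, with $*$-involution $x\mapsto x^c$, $t(x)=x+x^c$, $n(x)=xx^c=\|x\|^2$, $\mathrm{im}(x)=\frac12(x-x^c)$, and let $\mathbb{S}=\{J\in A: t(J)=0,\ n(J)=1\}$. For $y=\alpha+\beta I$ with $\alpha,\beta\in\mathbb{R}$, $I\in\mathbb{S}$, put $\mathbb{S}_y=\alpha+\beta\mathbb{S}$. Let $D\subseteq\mathbb{C}$ be invariant under complex conjugation and $\Omega=\Omega_D=\{\alpha+\beta J: \alpha,\beta\in\mathbb R,\ \alpha+\beta i\in D,\ J\in\mathbb{S}\}$. A stem function is a map $F=F_1+iF_2:D\to A\otimes_{\mathbb R}\mathbb{C}$ with $F_1(\bar z)=F_1(z)$, $F_2(\bar z)=-F_2(z)$; it induces the slice function $f=\mathcal{I}(F)\in\mathcal S(\Omega)$, $f(\alpha+\beta J)=F_1(\alpha+\beta i)+J\,F_2(\alpha+\beta i)$. The pointwise product of $A\otimes\mathbb{C}$ and the involution $F_1^c+iF_2^c$ on stem functions induce the slice product $f\cdot g$ and the slice conjugate $f^c$; $N(f)=f\cdot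 f^c$, and $f'_s(x)=\frac12\mathrm{im}(x)^{-1}(f(x)-f(x^c))$ for $x\in\Omega\setminus\mathbb{R}$. $V(\cdot)$ denotes a zero set. $f$ is of class $\mathcal S^0$ (resp. $\mathcal S^\omega$, on an open set) if its stem function is continuous (resp. real analytic), and slice regular (class $\mathcal{SR}$, on an open set) if its stem function is $C^1$ and holomorphic. **Theorem.** Let $f\in\mathcal S(\Omega)$ with $\Omega':=\Omega\setminus V(N(f))\ne\emptyset$, and let $f^{-\bullet}$ be the multiplicative inverse of $f|_{\Omega'}$ with respect to the slice product; it exists and is unique in $\mathcal S(\Omega')$. Then: 1. For all $x\in\Omega'\cap(\mathbb{R}\cup V(f'_s))$ and all $y\in\mathbb{S}_x$, $f^{-\bullet}(x)=f(x)^{-1}=f(y)^{-1}$. 2. Let $\Omega'':=\Omega'\setminus(\mathbb{R}\cup V(f'_s))$ and $$T_f(x):=\bigl(f^c(x)^{-1}\bigl((x f^c(x))f'_s(x)\bigr)\bigr)f'_s(x)^{-1}.$$ For all $x\in\Omega''$, $f^{-\bullet}(x)=f(T_f(x))^{-1}$. $T_f$ is a bijection of $\Omega''$ onto itself. For all $y\in\Omega''$,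 $T_f|_{\mathbb{S}_y}$ is a conformal transformation of $\mathbb{S}_y$ (a diffeomorphism of $\mathbb S_y$ onto itself whose differential at each point is a positive multiple of a linear isometry). If $f|_{\Omega''}\in\mathcal S^0(\Omega'')$, then $T_f$ is a homeomorphism of $\Omega''$ onto itself. The set $\Omega''$ constructed from $f^{-\bullet}\in\mathcal S(\Omega')$ equals that constructed from $f$, and $T_{f^{-\bullet}}$ is the inverse map of $T_f:\Omega''\to\Omega''$. 3. If $\Omega'$ is open, then $\mathcal{SR}(\Omega')\subseteq\mathcal S^\omega(\Omega')$. If $\Omega'$ is open and $f|_{\Omega'}\in\mathcal S^\omega(\Omega')$, then $f'_s$ extends to a real analytic function on $\Omega'$. Let $V$ be the zero set of the extension and $\widehat\Omega:=\Omega'\setminus V$. With $f'_s$ replaced by its extension, the formula for $T_f$ defines a real analytic diffeomorphism of $\widehat\Omega$ onto itself, and $f^{-\bullet}(x)=f(T_f(x))^{-1}$ for all $x\in\widehat\Omega$. Moreover $(f^{-\bullet})'_s$ also extends to a real analytic function on $\Omega'$, its extension has the same zero set $V$, and the map $T_{f^{-\bullet}}:\widehat\Omega\to\widehat\Omega$ defined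 through this extension is the inverse of $T_f:\widehat\Omega\to\widehat\Omega$. -/

import Mathlib

open scoped Quaternion ContDiff

noncomputable section

/-- The octonions `𝕆 = ℍ + ℓℍ`, as the Euclidean (`ℓ²`) product of two copies of the quaternions;
the pair `(α, β)` stands for `α + ℓβ`. -/
def Octonion : Type := WithLp 2 (ℍ[ℝ] × ℍ[ℝ])

namespace Octonion

instance : NormedAddCommGroup Octonion :=
  inferInstanceAs (NormedAddCommGroup (WithLp 2 (ℍ[ℝ] × ℍ[ℝ])))

instance : InnerProductSpace ℝ Octonion :=
  inferInstanceAs (InnerProductSpace ℝ (WithLp 2 (ℍ[ℝ] × ℍ[ℝ])))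

/-- The octonion `α + ℓβ`. -/
def mk (α β : ℍ[ℝ]) : Octonion := WithLp.toLp 2 (α, β)

/-- The component `α` of `α + ℓβ`. -/
def fst (x : Octonion) : ℍ[ℝ] := (WithLp.ofLp (p := 2) (V := ℍ[ℝ] × ℍ[ℝ]) x).1

/-- The component `β` of `α + ℓβ`. -/
def snd (x : Octonion) : ℍ[ℝ] := (WithLp.ofLp (p := 2) (V := ℍ[ℝ] × ℍ[ℝ]) x).2

instance : One Octonion := ⟨mk 1 0⟩

/-- `(α + ℓβ)(γ + ℓδ) = αγ - δβᶜ + ℓ(αᶜδ + γβ)`. -/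
instance : Mul Octonion :=
  ⟨fun x y => mk (x.fst * y.fst - y.snd * star x.snd) (star x.fst * y.snd + y.fst * x.snd)⟩

/-- `(α + ℓβ)ᶜ = αᶜ - ℓβ`. -/
instance : Star Octonion := ⟨fun x => mk (star x.fst) (-x.snd)⟩

end Octonion

namespace SliceFun

section Defs

variable {A B : Type*}
variable [NormedAddCommGroup A] [InnerProductSpace ℝ A] [Mul A] [One A] [Star A]
variable [NormedAddCommGroup B] [InnerProductSpace ℝ B] [Mul B] [One B] [Star B]

/-- `A` and `B` are isomorphic as (unital) `*`-algebras with Euclidean structure. -/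
def Iso (A B : Type*) [NormedAddCommGroup A] [InnerProductSpace ℝ A] [Mul A] [One A] [Star A]
    [NormedAddCommGroup B] [InnerProductSpace ℝ B] [Mul B] [One B] [Star B] : Prop :=
  ∃ φ : A ≃ₗᵢ[ℝ] B, φ 1 = 1 ∧ (∀ x y, φ (x * y) = φ x * φ y) ∧ ∀ x, φ (star x) = star (φ x)

/-- `A` is (a copy of) one of the `*`-algebras `ℂ`, `ℍ`, `𝕆`, with its Euclidean structure. -/
def IsCHO (A : Type*) [NormedAddCommGroup A] [InnerProductSpace ℝ A] [Mul A] [One A] [Star A] :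
    Prop :=
  Iso A ℂ ∨ Iso A ℍ[ℝ] ∨ Iso A Octonion

/-- The multiplicative inverse `x⁻¹ = n(x)⁻¹ xᶜ` of a nonzero element, where `n(x) = ‖x‖²`. -/
def cinv (x : A) : A := (‖x‖ ^ 2)⁻¹ • star x

/-- The imaginary part `(x - xᶜ) / 2`, as an element of `A`. -/
def im (x : A) : A := (1 / 2 : ℝ) • (x - star x)

/-- The real part `t(x) / 2`, as a real number. -/
def re (x : A) : ℝ := inner ℝ x 1

/-- `x` belongs to `ℝ ⊆ A`. -/
def IsReal (x : A) : Prop := ∃ r : ℝ, x = r • (1 : A)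

/-- The imaginary units: `t(J) = 0` and `n(J) = 1`. -/
def imUnits (A : Type*) [NormedAddCommGroup A] [InnerProductSpace ℝ A] [Mul A] [One A] [Star A] :
    Set A :=
  {J | J + star J = 0 ∧ J * star J = 1}

/-- The point `α + βJ` of `A` that corresponds to `z = α + βi` and to `J`. -/
def pt (z : ℂ) (J : A) : A := z.re • (1 : A) + z.im • J

/-- The circularization `Ω_D` of `D ⊆ ℂ`. -/
def circ (A : Type*) [NormedAddCommGroup A] [InnerProductSpace ℝ A] [Mul A] [One A] [Star A]
    (D : Set ℂ) : Set A :=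
  {x | ∃ z ∈ D, ∃ J ∈ imUnits A, x = pt z J}

/-- The set `D` of all `α + βi` such that `α + βJ ∈ E` for some imaginary unit `J`; for a circular
set `E` it is the conjugation-invariant `D` such that `E = Ω_D`. -/
def trace (E : Set A) : Set ℂ := {z | ∃ J ∈ imUnits A, pt z J ∈ E}

/-- The sphere `𝕊_y = α + β𝕊`, where `y = α + βI` with `I ∈ 𝕊`. -/
def sph (y : A) : Set A :=
  {x | ∃ z : ℂ, ∃ I ∈ imUnits A, ∃ J ∈ imUnits A, y = pt z I ∧ x = pt z J}

/-! Stem functions `F = F₁ + iF₂ : D → A ⊗ ℂ` are encoded by `F : ℂ → A × A`; only the values of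
`F` on `D` matter. -/

/-- `F` is a stem function on `D`: `F₁` is even and `F₂` is odd under complex conjugation. -/
def IsStem (D : Set ℂ) (F : ℂ → A × A) : Prop :=
  ∀ z ∈ D, (F (star z)).1 = (F z).1 ∧ (F (star z)).2 = -(F z).2

/-- The slice function `f = I(F)` induced by `F`, i.e. `f(α + βJ) = F₁(α + βi) + J F₂(α + βi)`
(see `slice_pt` below); here the representation `x = α + βJ` with `β = ‖im x‖ ≥ 0` is used. -/
def slice (F : ℂ → A × A) (x : A) : A :=
  (F ⟨re x, ‖im x‖⟩).1 + (‖im x‖⁻¹ • im x) * (F ⟨re x, ‖im x‖⟩).2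

/-- The pointwise product in `A ⊗ ℂ`; it induces the slice product. -/
def stemMul (F G : ℂ → A × A) (z : ℂ) : A × A :=
  ((F z).1 * (G z).1 - (F z).2 * (G z).2, (F z).1 * (G z).2 + (F z).2 * (G z).1)

/-- The pointwise `*`-involution `F₁ᶜ + iF₂ᶜ`; it induces the slice conjugate. -/
def stemConj (F : ℂ → A × A) (z : ℂ) : A × A := (star (F z).1, star (F z).2)

/-- The slice product `f · g` of `f = I(F)` and `g = I(G)`. -/
def sliceMul (F G : ℂ → A × A) : A → A := slice (stemMul F G)

/-- The slice conjugate `fᶜ` of `f = I(F)`. -/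
def sliceConj (F : ℂ → A × A) : A → A := slice (stemConj F)

/-- The normal function `N(f) = f · fᶜ` of `f = I(F)`. -/
def normal (F : ℂ → A × A) : A → A := sliceMul F (stemConj F)

/-- The spherical derivative `f'ₛ(x) = ½ im(x)⁻¹ (f(x) - f(xᶜ))` of `f = I(F)` at `x ∉ ℝ`. -/
def sphDeriv (F : ℂ → A × A) (x : A) : A :=
  (1 / 2 : ℝ) • (cinv (im x) * (slice F x - slice F (star x)))

/-- `Ω' = Ω ∖ V(N(f))`, where `Ω = Ω_D` and `f = I(F)`. -/
def Omega1 (D : Set ℂ) (F : ℂ → A × A) : Set A := {x | x ∈ circ A D ∧ normal F x ≠ 0}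

/-- `Ω'' = Ω' ∖ (ℝ ∪ V(f'ₛ))`. -/
def Omega2 (D : Set ℂ) (F : ℂ → A × A) : Set A :=
  {x | x ∈ Omega1 D F ∧ ¬ IsReal x ∧ sphDeriv F x ≠ 0}

/-- `g = I(G)` is a multiplicative inverse of (the restriction to `Ω_E` of) `f = I(F)` in the
algebra of slice functions on `Ω_E`. -/
def IsReciprocal (E : Set ℂ) (F G : ℂ → A × A) : Prop :=
  IsStem E G ∧ ∀ x ∈ circ A E, sliceMul F G x = 1 ∧ sliceMul G F x = 1

/-- `x ↦ (fᶜ(x)⁻¹ ((x fᶜ(x)) s(x))) s(x)⁻¹`, where `f = I(F)`. -/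
def transf (F : ℂ → A × A) (s : A → A) (x : A) : A :=
  (cinv (sliceConj F x) * ((x * sliceConj F x) * s x)) * cinv (s x)

/-- The transformation `T_f(x) = (fᶜ(x)⁻¹ ((x fᶜ(x)) f'ₛ(x))) f'ₛ(x)⁻¹`, where `f = I(F)`. -/
def T (F : ℂ → A × A) : A → A := transf F (sphDeriv F)

/-- `h` is a real analytic extension to `U` of the spherical derivative of `f = I(F)`. -/
def IsAnalyticExt (U : Set A) (F : ℂ → A × A) (h : A → A) : Prop :=
  AnalyticOnNhd ℝ h U ∧ ∀ x ∈ U, ¬ IsReal x → h x = sphDeriv F x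

/-- `f = I(F)` is slice regular on `Ω_D`: the stem function `F` is of class `C¹` on `D` and is
holomorphic for the complex structure `(a, b) ↦ (-b, a)` of `A ⊗ ℂ` (Cauchy-Riemann equations). -/
def IsSliceRegular (D : Set ℂ) (F : ℂ → A × A) : Prop :=
  ContDiffOn ℝ 1 F D ∧ ∀ z ∈ D,
    (fderiv ℝ F z Complex.I).1 = -(fderiv ℝ F z 1).2 ∧
    (fderiv ℝ F z Complex.I).2 = (fderiv ℝ F z 1).1

/-- `S` restricts to a homeomorphism of `U` onto itself. -/
def IsHomeoOn (S : A → A) (U : Set A) : Prop := ∃ e : U ≃ₜ U, ∀ x : U, (e x : A) = S x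

/-- `S` restricts to a real analytic diffeomorphism of (the open set) `U` onto itself. -/
def IsAnalyticDiffeoOn (S : A → A) (U : Set A) : Prop :=
  Set.BijOn S U U ∧ AnalyticOnNhd ℝ S U ∧
    ∃ S' : A → A, Set.InvOn S' S U U ∧ AnalyticOnNhd ℝ S' U

/-- `v` is tangent at `x` to the sphere `𝕊_x` (whose centre is the real part of `x`). -/
def IsTangent (x v : A) : Prop := star v = -v ∧ inner ℝ v (im x) = 0

/-- `S` restricts to a conformal transformation of the sphere `𝕊_y`: a smooth bijection of `𝕊_y`
with smooth inverse whose differential at each point is, on the tangent space, a positive multiple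
of a linear isometry. -/
def IsConformalOnSph (S : A → A) (y : A) : Prop :=
  Set.BijOn S (sph y) (sph y) ∧ ContDiffOn ℝ ∞ S (sph y) ∧
  (∃ S' : A → A, Set.InvOn S' S (sph y) (sph y) ∧ ContDiffOn ℝ ∞ S' (sph y)) ∧
  ∀ x ∈ sph y, ∃ L : A →L[ℝ] A, HasFDerivWithinAt S L (sph y) x ∧
    ∃ c : ℝ, 0 < c ∧ ∀ v w, IsTangent x v → IsTangent x w →
      (inner ℝ (L v) (L w) : ℝ) = c * inner ℝ v w

end Defs

/-! Sanity facts: the three algebras qualify, and `slice` is the function induced by a stem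
function. -/

theorem isCHO_complex : IsCHO ℂ :=
  Or.inl ⟨LinearIsometryEquiv.refl ℝ ℂ, rfl, fun _ _ => rfl, fun _ => rfl⟩

theorem isCHO_quaternion : IsCHO ℍ[ℝ] :=
  Or.inr (Or.inl ⟨LinearIsometryEquiv.refl ℝ _, rfl, fun _ _ => rfl, fun _ => rfl⟩)

theorem isCHO_octonion : IsCHO Octonion :=
  Or.inr (Or.inr ⟨LinearIsometryEquiv.refl ℝ _, rfl, fun _ _ => rfl, fun _ => rfl⟩)

/-- Elementary properties shared by `ℂ`, `ℍ`, `𝕆`. -/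
structure Basic (A : Type*) [NormedAddCommGroup A] [InnerProductSpace ℝ A] [Mul A] [One A]
    [Star A] : Prop where
  star_add (x y : A) : star (x + y) = star x + star y
  star_smul (r : ℝ) (x : A) : star (r • x) = r • star x
  star_one : star (1 : A) = 1
  mul_star (x : A) : x * star x = (‖x‖ ^ 2) • (1 : A)
  add_star (x : A) : x + star x = (2 * inner ℝ x 1 : ℝ) • (1 : A)
  norm_one : ‖(1 : A)‖ = 1
  smul_mul (r : ℝ) (x y : A) : (r • x) * y = r • (x * y)
  mul_smul (r : ℝ) (x y : A) : x * (r • y) = r • (x * y)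

theorem Basic.of_iso {A B : Type*}
    [NormedAddCommGroup A] [InnerProductSpace ℝ A] [Mul A] [One A] [Star A]
    [NormedAddCommGroup B] [InnerProductSpace ℝ B] [Mul B] [One B] [Star B]
    (h : Iso A B) (hB : Basic B) : Basic A := by
  obtain ⟨φ, h1, hm, hs⟩ := h
  refine ⟨fun x y => φ.injective ?_, fun r x => φ.injective ?_, φ.injective ?_,
    fun x => φ.injective ?_, fun x => φ.injective ?_, ?_, fun r x y => φ.injective ?_,
    fun r x y => φ.injective ?_⟩
  · simp [hs, hB.star_add]
  · simp [hs, hB.star_smul]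
  · simp [hs, h1, hB.star_one]
  · simp [hs, hm, h1, hB.mul_star]
  · rw [map_add, hs, hB.add_star, map_smul, h1, ← h1, φ.inner_map_map]
  · rw [← φ.norm_map, h1, hB.norm_one]
  · simp [hm, hB.smul_mul]
  · simp [hm, hB.mul_smul]

theorem basic_complex : Basic ℂ := by
  refine ⟨fun x y => by simp, fun r x => by simp, by simp, fun x => ?_, fun x => ?_, by simp,
    fun r x y => by simp [mul_assoc], fun r x y => by simp [mul_left_comm]⟩
  · rw [Complex.star_def, Complex.mul_conj, Complex.normSq_eq_norm_sq]; simp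
  · apply Complex.ext <;> simp [Complex.inner]; ring

theorem basic_quaternion : Basic ℍ[ℝ] := by
  refine ⟨fun x y => by simp, fun r x => by simp, by simp, fun x => ?_, fun x => ?_, by simp,
    fun r x y => by simp, fun r x y => by simp⟩
  · rw [Quaternion.self_mul_star, Quaternion.normSq_eq_norm_mul_self, ← sq]
    rw [← Quaternion.coe_mul_eq_smul, mul_one]
  · ext <;> simp [Quaternion.inner_def]; ring

theorem Octonion.ext' {x y : Octonion} (h1 : x.fst = y.fst) (h2 : x.snd = y.snd) : x = y :=
  (WithLp.ofLp_injective (V := ℍ[ℝ] × ℍ[ℝ]) 2) (Prod.ext h1 h2)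

theorem basic_octonion : Basic Octonion := by
  have i1 (x y : Octonion) : (inner ℝ x y : ℝ) = inner ℝ x.fst y.fst + inner ℝ x.snd y.snd := rfl
  have n1 (x : Octonion) : ‖x‖ ^ 2 = ‖x.fst‖ ^ 2 + ‖x.snd‖ ^ 2 := by
    rw [← real_inner_self_eq_norm_sq, ← real_inner_self_eq_norm_sq, ← real_inner_self_eq_norm_sq,
      i1]
  have af (x y : Octonion) : (x + y).fst = x.fst + y.fst := rfl
  have as (x y : Octonion) : (x + y).snd = x.snd + y.snd := rfl
  have sf (r : ℝ) (x : Octonion) : (r • x).fst = r • x.fst := rfl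
  have ss (r : ℝ) (x : Octonion) : (r • x).snd = r • x.snd := rfl
  have tf (x : Octonion) : (star x).fst = star x.fst := rfl
  have ts (x : Octonion) : (star x).snd = -x.snd := rfl
  have of : (1 : Octonion).fst = 1 := rfl
  have os : (1 : Octonion).snd = 0 := rfl
  have mf (x y : Octonion) : (x * y).fst = x.fst * y.fst - y.snd * star x.snd := rfl
  have ms (x y : Octonion) : (x * y).snd = star x.fst * y.snd + y.fst * x.snd := rfl
  refine ⟨fun x y => Octonion.ext' ?_ ?_, fun r x => Octonion.ext' ?_ ?_, Octonion.ext' ?_ ?_,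
    fun x => Octonion.ext' ?_ ?_, fun x => Octonion.ext' ?_ ?_, ?_,
    fun r x y => Octonion.ext' ?_ ?_, fun r x y => Octonion.ext' ?_ ?_⟩
  · simp [af, tf]
  · simp [as, ts, add_comm]
  · simp [sf, tf]
  · simp [ss, ts]
  · simp [of, tf]
  · simp [os, ts]
  · rw [mf, tf, ts, sf, of, n1, add_smul, ← basic_quaternion.mul_star, ← basic_quaternion.mul_star]
    simp
  · simp [ms, tf, ts, ss, os]
  · rw [af, tf, sf, of, i1, of, os, basic_quaternion.add_star]; simp
  · simp [as, ts, ss, os]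
  · have h := n1 1
    rw [of, os] at h
    have h' : ‖(1 : Octonion)‖ ^ 2 = 1 := by rw [h]; simp
    nlinarith [norm_nonneg (1 : Octonion)]
  · simp [mf, sf, ss, smul_sub]
  · simp [ms, sf, ss, smul_add]
  · simp [mf, sf, ss, smul_sub]
  · simp [ms, sf, ss, smul_add]

theorem IsCHO.basic {A : Type*} [NormedAddCommGroup A] [InnerProductSpace ℝ A] [Mul A] [One A]
    [Star A] (h : IsCHO A) : Basic A := by
  rcases h with h | h | h
  · exact .of_iso h basic_complex
  · exact .of_iso h basic_quaternion
  · exact .of_iso h basic_octonion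

theorem mul_cinv {A : Type*} [NormedAddCommGroup A] [InnerProductSpace ℝ A] [Mul A] [One A]
    [Star A] (hA : IsCHO A) {x : A} (hx : x ≠ 0) : x * cinv x = 1 := by
  have hb := hA.basic
  rw [cinv, hb.mul_smul, hb.mul_star, smul_smul, inv_mul_cancel₀ (by simpa using hx), one_smul]

theorem slice_pt {A : Type*} [NormedAddCommGroup A] [InnerProductSpace ℝ A] [Mul A] [One A]
    [Star A] (hA : IsCHO A) {D : Set ℂ} {F : ℂ → A × A} (hF : IsStem D F)
    {z : ℂ} (hz : z ∈ D) {J : A} (hJ : J ∈ imUnits A) :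
    slice F (pt z J) = (F z).1 + J * (F z).2 := by
  have hb := hA.basic
  obtain ⟨hJ1, hJ2⟩ := hJ
  have hs : star J = -J := by rw [eq_neg_iff_add_eq_zero, add_comm]; exact hJ1
  have one_ne : (1 : A) ≠ 0 := by intro h; have := hb.norm_one; simp [h] at this
  have hin : (inner ℝ J 1 : ℝ) = 0 := by
    have := hb.add_star J
    rw [hJ1] at this
    simpa [one_ne] using this.symm
  have hn : ‖J‖ = 1 := by
    have := hb.mul_star J
    rw [hJ2] at this
    have h2 : (‖J‖ ^ 2 - 1) • (1 : A) = 0 := by rw [sub_smul, ← this]; simp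
    have h3 : ‖J‖ ^ 2 = 1 := by simpa [one_ne, sub_eq_zero] using h2
    nlinarith [norm_nonneg J]
  have hre : re (pt z J) = z.re := by
    simp [re, pt, inner_add_left, inner_smul_left, hin, hb.norm_one]
  have him : im (pt z J) = z.im • J := by
    rw [im, pt, hb.star_add, hb.star_smul, hb.star_smul, hb.star_one, hs]
    module
  have hnim : ‖im (pt z J)‖ = |z.im| := by rw [him, norm_smul, hn]; simp
  have neg1 (x : A) : -x = (-1 : ℝ) • x := by simp
  rw [slice, hre, hnim, him]
  rcases lt_trichotomy z.im 0 with h | h | h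
  · have hz' : (⟨z.re, |z.im|⟩ : ℂ) = star z := by
      apply Complex.ext <;> simp [abs_of_neg h]
    rw [hz', (hF z hz).1, (hF z hz).2, abs_of_neg h, smul_smul, neg1, hb.mul_smul, hb.smul_mul,
      smul_smul]
    have : (-1 : ℝ) * ((-z.im)⁻¹ * z.im) = 1 := by
      have := h.ne
      field_simp
    rw [this, one_smul]
  · have hz' : (⟨z.re, |z.im|⟩ : ℂ) = z := by
      apply Complex.ext <;> simp [h]
    have h0 : (F z).2 = 0 := by
      have h1 : star z = z := by apply Complex.ext <;> simp [h]
      have := (hF z hz).2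
      rw [h1] at this
      have h2 : (2 : ℝ) • (F z).2 = 0 := by
        rw [two_smul]; exact eq_neg_iff_add_eq_zero.1 this
      simpa using h2
    have m0 (x : A) : x * 0 = 0 := by
      have := hb.mul_smul 0 x 0
      simpa using this
    rw [hz', h0, m0, m0]
  · have hz' : (⟨z.re, |z.im|⟩ : ℂ) = z := by
      apply Complex.ext <;> simp [abs_of_pos h]
    rw [hz', abs_of_pos h, smul_smul, inv_mul_cancel₀ h.ne', one_smul]

end SliceFun

end

open SliceFun

/-! Associativity fails in the octonions, so everything rests on the identities `star_mul_mul` and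
`inner_mul_left` (left multiplication by `star x` undoes, and is adjoint to, left multiplication by
`x`), together with their mirror images and polarisations.

The problem is first made pointwise. A stem value is a pair `p` in `A ⊗ ℂ`, its product with its
conjugate is a complex number `nn p`, and `p` is invertible when `nn p ≠ 0`, with inverse `pinv p`
equal to the conjugate divided by `nn p`. Hence the reciprocal stem function is `pinv (F z)`; its
uniqueness is `eq_pinv`, and `isReciprocal_iff` carries this to slice functions. The formula for
`T_f` comes from `ev_pconj_mul`: with `a = fᶜ(x)` and `x = α + βJ`, the element `a p₁ + (J a) p₂` is
the value of `N(f)` at `x`. Pulling `a` out on the left turns `J` into the unit `K` given by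
`twist`, so that `f(α + βK) = a⁻¹ N(f)(x)`, whose inverse is `f⁻•(x)` (`cinv_ev_twist`).

Since a slice function with `F₂ ≠ 0` is injective on each sphere, applying this relation to `f` and
then to `g = f⁻•` shows that `T_g` undoes `T_f` (`Recip.leftInvOn`). The predicate `IsSphDeriv`
leaves the values on the real line free, so one argument serves both the punctured domain (extension
by zero) and the analytic extension. On one sphere `f` and `g` are affine similarities, and `T_f` is
`f⁻¹ ∘ inv ∘ g` there, hence conformal.

In the analytic case the difficulty lies on the real axis, where `‖im x‖` is not smooth. There `F₁`
and `F₂ / β` are analytic functions of `(α, β²)` (`IsStem.exists_even_odd`), and `‖im x‖²` is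
smooth. To obtain this, `exists_resolvent` writes an analytic germ as a coefficient of a resolvent
of a linear operator family, whose even and odd parts in `β` are explicit. -/

noncomputable section

namespace SliceFun

/-! ### The three normed algebras and their common properties -/

/-- The algebraic properties shared by `ℂ`, `ℍ`, `𝕆`: a finite-dimensional alternative `*`-algebra
whose norm is multiplicative. -/
class CompAlg (A : Type*) [NormedAddCommGroup A] [InnerProductSpace ℝ A] [Mul A] [One A]
    [Star A] : Prop where
  basic : Basic A
  add_mul (x y z : A) : (x + y) * z = x * z + y * z
  mul_add (x y z : A) : x * (y + z) = x * y + x * z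
  one_mul (x : A) : 1 * x = x
  mul_one (x : A) : x * 1 = x
  star_mul (x y : A) : star (x * y) = star y * star x
  star_star (x : A) : star (star x) = x
  star_mul_mul (x y : A) : star x * (x * y) = (‖x‖ ^ 2) • y
  inner_mul_left (x y z : A) : (inner ℝ (x * y) z : ℝ) = inner ℝ y (star x * z)
  inner_star (x y : A) : (inner ℝ (star x) (star y) : ℝ) = inner ℝ x y
  finite : FiniteDimensional ℝ A
  exists_unit : ∃ J : A, J ∈ imUnits A

theorem CompAlg.of_iso {A B : Type*}
    [NormedAddCommGroup A] [InnerProductSpace ℝ A] [Mul A] [One A] [Star A]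
    [NormedAddCommGroup B] [InnerProductSpace ℝ B] [Mul B] [One B] [Star B]
    (h : Iso A B) (hB : CompAlg B) : CompAlg A := by
  have hb := Basic.of_iso h hB.basic
  obtain ⟨φ, h1, hm, hs⟩ := h
  refine ⟨hb, fun x y z => φ.injective ?_, fun x y z => φ.injective ?_, fun x => φ.injective ?_,
    fun x => φ.injective ?_, fun x y => φ.injective ?_, fun x => φ.injective ?_,
    fun x y => φ.injective ?_, fun x y z => ?_, fun x y => ?_, ?_, ?_⟩
  · simp [hm, hB.add_mul]
  · simp [hm, hB.mul_add]
  · simp [hm, h1, hB.one_mul]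
  · simp [hm, h1, hB.mul_one]
  · simp [hm, hs, hB.star_mul]
  · simp [hs, hB.star_star]
  · simp [hm, hs, hB.star_mul_mul]
  · rw [← φ.inner_map_map, ← φ.inner_map_map, hm, hm, hs, hB.inner_mul_left]
  · rw [← φ.inner_map_map, hs, hs, hB.inner_star, φ.inner_map_map]
  · have := hB.finite
    exact φ.symm.toLinearEquiv.finiteDimensional
  · obtain ⟨J, hJ1, hJ2⟩ := hB.exists_unit
    refine ⟨φ.symm J, φ.injective ?_, φ.injective ?_⟩
    · simpa [hs] using hJ1
    · simpa [hs, hm, h1] using hJ2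

theorem compAlg_complex : CompAlg ℂ where
  basic := basic_complex
  add_mul := _root_.add_mul
  mul_add := _root_.mul_add
  one_mul := _root_.one_mul
  mul_one := _root_.mul_one
  star_mul := StarMul.star_mul
  star_star := _root_.star_star
  star_mul_mul x y := by
    rw [← mul_assoc, mul_comm (star x), basic_complex.mul_star, smul_mul_assoc, _root_.one_mul]
  inner_mul_left x y z := by simp [Complex.inner]; ring
  inner_star x y := by simp [Complex.inner]
  finite := inferInstance
  exists_unit := ⟨Complex.I, by simp [imUnits]⟩

theorem compAlg_quaternion : CompAlg ℍ[ℝ] where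
  basic := basic_quaternion
  add_mul := _root_.add_mul
  mul_add := _root_.mul_add
  one_mul := _root_.one_mul
  mul_one := _root_.mul_one
  star_mul := StarMul.star_mul
  star_star := _root_.star_star
  star_mul_mul x y := by
    have := basic_quaternion.mul_star (star x)
    rw [_root_.star_star, norm_star] at this
    rw [← mul_assoc, this, smul_mul_assoc, _root_.one_mul]
  inner_mul_left x y z := by simp [Quaternion.inner_def]; ring
  inner_star x y := by simp [Quaternion.inner_def]
  finite := inferInstance
  exists_unit := by
    obtain ⟨i, h0, h1, h2, h3⟩ : ∃ i : ℍ[ℝ], i.re = 0 ∧ i.imI = 1 ∧ i.imJ = 0 ∧ i.imK = 0 :=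
      ⟨⟨0, 1, 0, 0⟩, rfl, rfl, rfl, rfl⟩
    refine ⟨i, ?_, ?_⟩
    · ext <;> simp [h0]
    · ext <;> simp [h0, h1, h2, h3]

theorem compAlg_octonion : CompAlg Octonion := by
  have i1 (x y : Octonion) : (inner ℝ x y : ℝ) = inner ℝ x.fst y.fst + inner ℝ x.snd y.snd := rfl
  have n1 (x : Octonion) : ‖x‖ ^ 2 = ‖x.fst‖ ^ 2 + ‖x.snd‖ ^ 2 := by
    rw [← real_inner_self_eq_norm_sq, ← real_inner_self_eq_norm_sq, ← real_inner_self_eq_norm_sq,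
      i1]
  have af (x y : Octonion) : (x + y).fst = x.fst + y.fst := rfl
  have as (x y : Octonion) : (x + y).snd = x.snd + y.snd := rfl
  have sf (r : ℝ) (x : Octonion) : (r • x).fst = r • x.fst := rfl
  have ss (r : ℝ) (x : Octonion) : (r • x).snd = r • x.snd := rfl
  have tf (x : Octonion) : (star x).fst = star x.fst := rfl
  have ts (x : Octonion) : (star x).snd = -x.snd := rfl
  have of : (1 : Octonion).fst = 1 := rfl
  have os : (1 : Octonion).snd = 0 := rfl
  have mf (x y : Octonion) : (x * y).fst = x.fst * y.fst - y.snd * star x.snd := rfl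
  have ms (x y : Octonion) : (x * y).snd = star x.fst * y.snd + y.fst * x.snd := rfl
  have q1 (a b : ℍ[ℝ]) : star a * (a * b) = ‖a‖ ^ 2 • b := compAlg_quaternion.star_mul_mul a b
  have q1' (a b : ℍ[ℝ]) : a * (star a * b) = ‖a‖ ^ 2 • b := by
    have := q1 (star a) b
    rwa [_root_.star_star, norm_star] at this
  have q2 (a b : ℍ[ℝ]) : b * a * star a = ‖a‖ ^ 2 • b := by
    rw [mul_assoc, basic_quaternion.mul_star]; simp
  have q2' (a b : ℍ[ℝ]) : b * star a * a = ‖a‖ ^ 2 • b := by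
    have := q2 (star a) b
    rwa [_root_.star_star, norm_star] at this
  refine ⟨basic_octonion, fun x y z => Octonion.ext' ?_ ?_, fun x y z => Octonion.ext' ?_ ?_,
    fun x => Octonion.ext' ?_ ?_, fun x => Octonion.ext' ?_ ?_, fun x y => Octonion.ext' ?_ ?_,
    fun x => Octonion.ext' ?_ ?_, fun x y => Octonion.ext' ?_ ?_, fun x y z => ?_, fun x y => ?_,
    ?_, ?_⟩
  · simp only [af, as, mf, star_add, add_mul, mul_add]; abel
  · simp only [af, as, ms, star_add, add_mul, mul_add]; abel
  · simp only [af, as, mf, add_mul, mul_add]; abel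
  · simp only [af, as, ms, add_mul, mul_add]; abel
  · simp [mf, of, os]
  · simp [ms, of, os]
  · simp [mf, of, os]
  · simp [ms, of, os]
  · simp [mf, tf, ts]
  · simp [ms, tf, ts]
  · simp [tf]
  · simp [ts]
  · rw [sf, n1, add_smul, ← q1 x.fst, ← q2' x.snd]
    simp only [mf, ms, tf, ts, add_mul, mul_sub, star_neg, mul_neg, mul_assoc]
    -- The two products differ in order only, and both are the real scalar `‖x.snd‖ ^ 2`.
    have : y.fst * (x.snd * star x.snd) = y.fst * (star x.snd * x.snd) := by
      rw [← mul_assoc, ← mul_assoc, q2, q2']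
    rw [this]
    abel
  · rw [ss, n1, add_smul, ← q1' x.fst, ← q2' x.snd]
    simp only [mf, ms, tf, ts, mul_add, sub_mul, _root_.star_star, mul_neg,
      mul_assoc]
    abel
  · simp only [i1, mf, ms, tf, ts, Quaternion.inner_def]
    simp
    ring
  · simp [i1, tf, ts, Quaternion.inner_def]
  · exact inferInstanceAs (FiniteDimensional ℝ (WithLp 2 (ℍ[ℝ] × ℍ[ℝ])))
  · obtain ⟨i, hi1, hi2⟩ := compAlg_quaternion.exists_unit
    have f1 : (Octonion.mk i 0).fst = i := rfl
    have f2 : (Octonion.mk i 0).snd = 0 := rfl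
    refine ⟨Octonion.mk i 0, Octonion.ext' ?_ ?_, Octonion.ext' ?_ ?_⟩
    · rw [af, tf, f1, hi1]; rfl
    · rw [as, ts, f2, neg_zero, add_zero]; rfl
    · rw [mf, tf, ts, f1, f2, hi2, of]; simp
    · rw [ms, tf, ts, f1, f2, os]; simp

theorem IsCHO.compAlg {A : Type*} [NormedAddCommGroup A] [InnerProductSpace ℝ A] [Mul A] [One A]
    [Star A] (h : IsCHO A) : CompAlg A := by
  rcases h with h | h | h
  · exact .of_iso h compAlg_complex
  · exact .of_iso h compAlg_quaternion
  · exact .of_iso h compAlg_octonion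

/-! ### Calculus without associativity; inverses and imaginary units -/

section Algebra

variable {A : Type*} [NormedAddCommGroup A] [InnerProductSpace ℝ A] [Mul A] [One A] [Star A]
  [CompAlg A]

instance CompAlg.nonAssocRing : NonAssocRing A :=
  { (inferInstance : AddCommGroup A) with
    mul := (· * ·)
    one := 1
    left_distrib := CompAlg.mul_add
    right_distrib := CompAlg.add_mul
    zero_mul := fun x => by simpa using CompAlg.basic.smul_mul 0 (0 : A) x
    mul_zero := fun x => by simpa using CompAlg.basic.mul_smul 0 x (0 : A)
    one_mul := CompAlg.one_mul
    mul_one := CompAlg.mul_one }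

instance CompAlg.isScalarTower : IsScalarTower ℝ A A := ⟨fun r x y => basic.smul_mul r x y⟩

instance CompAlg.smulCommClass : SMulCommClass ℝ A A := ⟨fun r x y => (basic.mul_smul r x y).symm⟩

instance CompAlg.starRing : StarRing A where
  star_involutive := CompAlg.star_star
  star_mul := CompAlg.star_mul
  star_add := CompAlg.basic.star_add

instance CompAlg.starModule : StarModule ℝ A := ⟨fun r x => by simpa using basic.star_smul r x⟩

instance CompAlg.finiteDimensional : FiniteDimensional ℝ A := CompAlg.finite

theorem inner_star_star (x y : A) : (inner ℝ (star x) (star y) : ℝ) = inner ℝ x y :=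
  CompAlg.inner_star x y

theorem norm_one' : ‖(1 : A)‖ = 1 := CompAlg.basic.norm_one

instance CompAlg.nontrivial : Nontrivial A :=
  ⟨⟨1, 0, fun h => by have := norm_one' (A := A); simp [h] at this⟩⟩

@[simp] theorem norm_star' (x : A) : ‖star x‖ = ‖x‖ := by
  have := inner_star_star x x
  rw [real_inner_self_eq_norm_sq, real_inner_self_eq_norm_sq] at this
  exact (sq_eq_sq₀ (norm_nonneg _) (norm_nonneg _)).1 this

theorem star_mul_mul (x y : A) : star x * (x * y) = (‖x‖ ^ 2) • y := CompAlg.star_mul_mul x y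

theorem mul_star_mul (x y : A) : x * (star x * y) = (‖x‖ ^ 2) • y := by
  simpa using star_mul_mul (star x) y

theorem mul_mul_star (x y : A) : y * x * star x = (‖x‖ ^ 2) • y := by
  apply star_injective
  simpa using mul_star_mul x (star y)

theorem mul_star_mul' (x y : A) : y * star x * x = (‖x‖ ^ 2) • y := by
  simpa using mul_mul_star (star x) y

theorem inner_mul_left (x y z : A) : (inner ℝ (x * y) z : ℝ) = inner ℝ y (star x * z) :=
  CompAlg.inner_mul_left x y z

theorem inner_mul_right (x y z : A) : (inner ℝ (y * x) z : ℝ) = inner ℝ y (z * star x) := by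
  rw [← inner_star_star, star_mul, inner_mul_left, ← inner_star_star]
  simp

theorem inner_mul_mul_left (x y z : A) :
    (inner ℝ (x * y) (x * z) : ℝ) = ‖x‖ ^ 2 * inner ℝ y z := by
  rw [inner_mul_left, star_mul_mul, real_inner_smul_right]

theorem inner_mul_mul_right (x y z : A) :
    (inner ℝ (y * x) (z * x) : ℝ) = ‖x‖ ^ 2 * inner ℝ y z := by
  rw [inner_mul_right, mul_mul_star, real_inner_smul_right]

/-- Left multiplication by `x` scales inner products by `‖x‖ ^ 2`; take both arguments equal to `y`.
-/
theorem norm_mul' (x y : A) : ‖x * y‖ = ‖x‖ * ‖y‖ := by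
  have := inner_mul_mul_left x y y
  rw [real_inner_self_eq_norm_sq, real_inner_self_eq_norm_sq, ← mul_pow] at this
  exact (sq_eq_sq₀ (norm_nonneg _) (by positivity)).1 this

instance CompAlg.noZeroDivisors : NoZeroDivisors A where
  eq_zero_or_eq_zero_of_mul_eq_zero {x y} h := by
    have := norm_mul' x y
    rw [h, norm_zero, eq_comm, mul_eq_zero] at this
    simpa using this

theorem norm_add_sq' (x y : A) : ‖x + y‖ ^ 2 = ‖x‖ ^ 2 + 2 * inner ℝ x y + ‖y‖ ^ 2 :=
  norm_add_sq_real x y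

/-- Polarisation of `star_mul_mul` in `x`. This and its three variants stand in for associativity in
the mixed terms of later expansions. -/
theorem star_mul_mul_add (x z y : A) :
    star x * (z * y) + star z * (x * y) = (2 * inner ℝ x z : ℝ) • y := by
  have h := star_mul_mul (x + z) y
  rw [norm_add_sq', star_add, add_mul, add_mul, mul_add, mul_add, star_mul_mul, star_mul_mul,
    add_smul, add_smul] at h
  linear_combination (norm := module) h

theorem mul_star_mul_add (x z y : A) :
    x * (star z * y) + z * (star x * y) = (2 * inner ℝ x z : ℝ) • y := by
  simpa [inner_star_star] using star_mul_mul_add (star x) (star z) y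

theorem mul_mul_star_add (x z y : A) :
    y * x * star z + y * z * star x = (2 * inner ℝ x z : ℝ) • y := by
  apply star_injective
  have := mul_star_mul_add z x (star y)
  rw [real_inner_comm] at this
  simpa using this

theorem mul_star_mul_add' (x z y : A) :
    y * star x * z + y * star z * x = (2 * inner ℝ x z : ℝ) • y := by
  simpa [inner_star_star] using mul_mul_star_add (star x) (star z) y

theorem mul_star' (x : A) : x * star x = (‖x‖ ^ 2) • (1 : A) := CompAlg.basic.mul_star x

theorem star_mul_self' (x : A) : star x * x = (‖x‖ ^ 2) • (1 : A) := by
  simpa using mul_star' (star x)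

theorem mul_star_add_mul_star (x y : A) :
    x * star y + y * star x = (2 * inner ℝ x y : ℝ) • (1 : A) := by
  simpa using mul_star_mul_add x y 1

/-! ### Inverses -/

theorem norm_cinv (x : A) : ‖cinv x‖ = ‖x‖⁻¹ := by
  by_cases hx : x = 0
  · simp [cinv, hx]
  · have : ‖x‖ ≠ 0 := norm_ne_zero_iff.2 hx
    rw [cinv, norm_smul, norm_star', norm_inv, norm_pow, norm_norm]
    field_simp

theorem cinv_ne_zero {x : A} (hx : x ≠ 0) : cinv x ≠ 0 := by
  rw [← norm_ne_zero_iff, norm_cinv]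
  exact inv_ne_zero (norm_ne_zero_iff.2 hx)

theorem norm_sq_inv_mul {x : A} (hx : x ≠ 0) : (‖x‖ ^ 2)⁻¹ * ‖x‖ ^ 2 = 1 :=
  inv_mul_cancel₀ (pow_ne_zero 2 (norm_ne_zero_iff.2 hx))

theorem cinv_mul_mul {x : A} (hx : x ≠ 0) (y : A) : cinv x * (x * y) = y := by
  rw [cinv, smul_mul_assoc, star_mul_mul, smul_smul, norm_sq_inv_mul hx, one_smul]

theorem mul_mul_cinv {x : A} (hx : x ≠ 0) (y : A) : y * x * cinv x = y := by
  rw [cinv, mul_smul_comm, mul_mul_star, smul_smul, norm_sq_inv_mul hx, one_smul]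

theorem mul_cinv_mul' {x : A} (hx : x ≠ 0) (y : A) : y * cinv x * x = y := by
  rw [cinv, mul_smul_comm, smul_mul_assoc, mul_star_mul', smul_smul, norm_sq_inv_mul hx, one_smul]

theorem eq_cinv_of_mul_eq_one {x y : A} (h : x * y = 1) : y = cinv x := by
  have hx : x ≠ 0 := by rintro rfl; simp at h
  rw [← cinv_mul_mul hx y, h, mul_one]

theorem cinv_mul_self {x : A} (hx : x ≠ 0) : cinv x * x = 1 := by
  simpa using cinv_mul_mul hx 1

theorem mul_cinv' {s : A} (hs : s ≠ 0) : s * cinv s = 1 := by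
  simpa using mul_mul_cinv hs 1

theorem cinv_cinv {x : A} (hx : x ≠ 0) : cinv (cinv x) = x :=
  (eq_cinv_of_mul_eq_one (cinv_mul_self hx)).symm

theorem cinv_mul (x y : A) : cinv (x * y) = cinv y * cinv x := by
  rw [cinv, cinv, cinv, norm_mul', star_mul, mul_smul_comm, smul_mul_assoc, smul_smul, mul_pow,
    mul_inv]

theorem cinv_smul (r : ℝ) (x : A) : cinv (r • x) = r⁻¹ • cinv x := by
  rw [cinv, cinv, norm_smul, star_smul, star_trivial, smul_smul, smul_smul, mul_pow,
    Real.norm_eq_abs, sq_abs]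
  by_cases hr : r = 0
  · simp [hr]
  · congr 1
    field_simp

/-! ### Imaginary units and the points `α + βJ` -/

theorem star_of_mem_imUnits {J : A} (hJ : J ∈ imUnits A) : star J = -J := by
  rw [eq_neg_iff_add_eq_zero, add_comm]; exact hJ.1

theorem norm_of_mem_imUnits {J : A} (hJ : J ∈ imUnits A) : ‖J‖ = 1 := by
  have h := hJ.2
  rw [mul_star'] at h
  have h2 : (‖J‖ ^ 2 - 1) • (1 : A) = 0 := by rw [sub_smul, h, one_smul, sub_self]
  have h3 : ‖J‖ ^ 2 = 1 := by simpa [sub_eq_zero] using h2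
  nlinarith [norm_nonneg J]

theorem mem_imUnits_iff {J : A} : J ∈ imUnits A ↔ star J = -J ∧ ‖J‖ = 1 := by
  refine ⟨fun h => ⟨star_of_mem_imUnits h, norm_of_mem_imUnits h⟩, fun ⟨h1, h2⟩ => ⟨?_, ?_⟩⟩
  · rw [h1, add_neg_cancel]
  · rw [mul_star', h2]; simp

theorem star_eq (x : A) : star x = (2 * inner ℝ x 1 : ℝ) • (1 : A) - x :=
  eq_sub_of_add_eq' (CompAlg.basic.add_star x)

theorem star_eq_neg_iff {x : A} : star x = -x ↔ (inner ℝ x 1 : ℝ) = 0 := by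
  rw [star_eq, sub_eq_neg_self]
  simp

theorem inner_one_of_mem_imUnits {J : A} (hJ : J ∈ imUnits A) : (inner ℝ J 1 : ℝ) = 0 :=
  star_eq_neg_iff.1 (star_of_mem_imUnits hJ)

theorem ne_zero_of_mem_imUnits {J : A} (hJ : J ∈ imUnits A) : J ≠ 0 := by
  rintro rfl
  simpa using norm_of_mem_imUnits hJ

theorem neg_mem_imUnits {J : A} (hJ : J ∈ imUnits A) : -J ∈ imUnits A := by
  rw [mem_imUnits_iff, star_neg, star_of_mem_imUnits hJ, norm_neg, norm_of_mem_imUnits hJ]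
  simp

theorem mul_mul_of_mem_imUnits {J : A} (hJ : J ∈ imUnits A) (x : A) : J * (J * x) = -x := by
  have := star_mul_mul J x
  rw [star_of_mem_imUnits hJ, norm_of_mem_imUnits hJ] at this
  simpa [neg_eq_iff_eq_neg] using this

variable (A) in
theorem exists_mem_imUnits : ∃ J : A, J ∈ imUnits A := CompAlg.exists_unit

theorem re_pt (z : ℂ) {J : A} (hJ : J ∈ imUnits A) : re (pt z J) = z.re := by
  simp [re, pt, inner_add_left, inner_smul_left, inner_one_of_mem_imUnits hJ, norm_one']

theorem star_pt (z : ℂ) {J : A} (hJ : J ∈ imUnits A) : star (pt z J) = pt (star z) J := by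
  simp [pt, star_of_mem_imUnits hJ]

theorem im_pt (z : ℂ) {J : A} (hJ : J ∈ imUnits A) : im (pt z J) = z.im • J := by
  rw [im, star_pt z hJ, pt, pt, Complex.star_def, Complex.conj_re, Complex.conj_im]
  module

theorem pt_neg (z : ℂ) (J : A) : pt z (-J) = pt (star z) J := by
  simp [pt]

theorem norm_im_pt (z : ℂ) {J : A} (hJ : J ∈ imUnits A) : ‖im (pt z J)‖ = |z.im| := by
  rw [im_pt z hJ, norm_smul, norm_of_mem_imUnits hJ, mul_one, Real.norm_eq_abs]

theorem pt_eq_of_im_eq_zero {z : ℂ} (hz : z.im = 0) (J : A) : pt z J = z.re • (1 : A) := by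
  simp [pt, hz]

theorem pt_inj_left {z w : ℂ} {J : A} (hJ : J ∈ imUnits A) (h : pt z J = pt w J) : z = w := by
  have h1 := congrArg re h
  have h2 := congrArg im h
  rw [re_pt z hJ, re_pt w hJ] at h1
  rw [im_pt z hJ, im_pt w hJ] at h2
  exact Complex.ext h1 (smul_left_injective ℝ (ne_zero_of_mem_imUnits hJ) h2)

theorem pt_zero (J : A) : pt (0 : ℂ) J = 0 := by simp [pt]

theorem pt_eq_zero_iff {z : ℂ} {J : A} (hJ : J ∈ imUnits A) : pt z J = 0 ↔ z = 0 :=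
  ⟨fun h => pt_inj_left hJ (by rw [h, pt_zero]), fun h => by rw [h, pt_zero]⟩

theorem isReal_pt_iff {z : ℂ} {J : A} (hJ : J ∈ imUnits A) : IsReal (pt z J) ↔ z.im = 0 := by
  constructor
  · rintro ⟨r, hr⟩
    have h : pt z J = pt (r : ℂ) J := by rw [hr]; simp [pt]
    simpa using congrArg Complex.im (pt_inj_left hJ h)
  · exact fun h => ⟨z.re, pt_eq_of_im_eq_zero h J⟩

theorem star_im (x : A) : star (im x) = -im x := by
  rw [im, star_smul, star_sub, star_star, star_trivial, ← smul_neg, neg_sub]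

theorem re_smul_one_add_im (x : A) : re x • (1 : A) + im x = x := by
  rw [im, star_eq, re]
  module

/-- Every point is of the form `α + βJ` with `β ≥ 0`. -/
theorem exists_pt (x : A) : ∃ J ∈ imUnits A, x = pt ⟨re x, ‖im x‖⟩ J := by
  by_cases h : im x = 0
  · obtain ⟨J, hJ⟩ := exists_mem_imUnits A
    refine ⟨J, hJ, ?_⟩
    have := re_smul_one_add_im x
    rw [h, add_zero] at this
    simp [pt, h, this]
  · have hn : ‖im x‖ ≠ 0 := norm_ne_zero_iff.2 h
    refine ⟨‖im x‖⁻¹ • im x, mem_imUnits_iff.2 ⟨?_, ?_⟩, ?_⟩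
    · rw [star_smul, star_im, star_trivial, smul_neg]
    · rw [norm_smul, norm_inv, norm_norm, inv_mul_cancel₀ hn]
    · rw [pt, smul_smul, mul_inv_cancel₀ hn, one_smul, re_smul_one_add_im]

/-- A point determines its real part and the norm of its imaginary part, so `z` is determined up to
conjugation. -/
theorem pt_eq_pt {z w : ℂ} {I J : A} (hI : I ∈ imUnits A) (hJ : J ∈ imUnits A)
    (h : pt z I = pt w J) : w = z ∨ w = star z := by
  have h1 := congrArg re h
  have h2 := congrArg (fun x => ‖im x‖) h
  simp only [re_pt _ hI, re_pt _ hJ, norm_im_pt _ hI, norm_im_pt _ hJ] at h1 h2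
  rcases abs_eq_abs.1 h2 with h2 | h2
  · exact Or.inl (Complex.ext h1.symm h2.symm)
  · exact Or.inr (Complex.ext (by simp [h1]) (by simp [h2]))

end Algebra

/-! ### The algebra `A ⊗ ℂ` and its evaluations at imaginary units -/

section Pairs

set_option linter.unusedSectionVars false

variable {A : Type*} [NormedAddCommGroup A] [InnerProductSpace ℝ A] [Mul A] [One A] [Star A]

/-- The product of `A ⊗ ℂ`. -/
def pmul (p q : A × A) : A × A := (p.1 * q.1 - p.2 * q.2, p.1 * q.2 + p.2 * q.1)

/-- The `*`-involution of `A ⊗ ℂ`. -/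
def pconj (p : A × A) : A × A := (star p.1, star p.2)

/-- The multiplication by complex scalars in `A ⊗ ℂ`. -/
def csmul (w : ℂ) (p : A × A) : A × A := (w.re • p.1 - w.im • p.2, w.re • p.2 + w.im • p.1)

/-- The complex number `p pᶜ` for `p ∈ A ⊗ ℂ`. -/
def nn (p : A × A) : ℂ := ⟨‖p.1‖ ^ 2 - ‖p.2‖ ^ 2, 2 * inner ℝ p.1 p.2⟩

/-- The inverse in `A ⊗ ℂ`. -/
def pinv (p : A × A) : A × A := csmul (nn p)⁻¹ (pconj p)

/-- The value at `α + βJ` of a slice function whose stem function has the value `p` at `α + βi`. -/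
def ev (J : A) (p : A × A) : A := p.1 + J * p.2

theorem stemMul_apply (F G : ℂ → A × A) (z : ℂ) : stemMul F G z = pmul (F z) (G z) := rfl

theorem stemConj_apply (F : ℂ → A × A) (z : ℂ) : stemConj F z = pconj (F z) := rfl

theorem csmul_csmul (v w : ℂ) (p : A × A) : csmul v (csmul w p) = csmul (v * w) p := by
  ext <;> simp only [csmul, Complex.mul_re, Complex.mul_im] <;> module

theorem csmul_one (p : A × A) : csmul 1 p = p := by
  simp [csmul]

variable [CompAlg A]

theorem pmul_csmul (w : ℂ) (p q : A × A) : pmul p (csmul w q) = csmul w (pmul p q) := by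
  ext <;> simp only [csmul, pmul, mul_sub, mul_add, mul_smul_comm, smul_sub, smul_add] <;> abel

theorem csmul_pmul (w : ℂ) (p q : A × A) : pmul (csmul w p) q = csmul w (pmul p q) := by
  ext <;> simp only [csmul, pmul, sub_mul, add_mul, smul_mul_assoc, smul_sub, smul_add] <;> abel

theorem pconj_pconj (p : A × A) : pconj (pconj p) = p := by simp [pconj]

theorem nn_pconj (p : A × A) : nn (pconj p) = nn p := by
  simp [nn, pconj, inner_star_star]

theorem pmul_pconj (p : A × A) : pmul p (pconj p) = csmul (nn p) (1, 0) := by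
  have := mul_star_add_mul_star p.1 p.2
  ext
  · simp [pmul, pconj, csmul, nn, mul_star', sub_smul]
  · simp [pmul, pconj, csmul, nn, this]

theorem pconj_pmul (p : A × A) : pmul (pconj p) p = csmul (nn p) (1, 0) := by
  simpa [pconj_pconj, nn_pconj] using pmul_pconj (pconj p)

/-- The complexified form of `star_mul_mul`: the diagonal terms use it directly, the cross terms use
its polarisation. It yields uniqueness of right inverses although `A ⊗ ℂ` need not be associative.
-/
theorem pconj_pmul_pmul (p q : A × A) : pmul (pconj p) (pmul p q) = csmul (nn p) q := by
  have h1 := star_mul_mul_add p.1 p.2 q.1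
  have h2 := star_mul_mul_add p.1 p.2 q.2
  ext
  · simp only [pmul, pconj, csmul, nn, mul_sub, mul_add, star_mul_mul]
    linear_combination (norm := module) -h2
  · simp only [pmul, pconj, csmul, nn, mul_sub, mul_add, star_mul_mul]
    linear_combination (norm := module) h1

theorem pmul_one (p : A × A) : pmul p (1, 0) = p := by simp [pmul]

theorem nn_csmul (w : ℂ) (p : A × A) : nn (csmul w p) = w ^ 2 * nn p := by
  have h1 : ‖w.re • p.1 - w.im • p.2‖ ^ 2
      = w.re ^ 2 * ‖p.1‖ ^ 2 - 2 * (w.re * w.im * inner ℝ p.1 p.2) + w.im ^ 2 * ‖p.2‖ ^ 2 := by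
    rw [norm_sub_sq_real, norm_smul, norm_smul, mul_pow, mul_pow, Real.norm_eq_abs,
      Real.norm_eq_abs, sq_abs, sq_abs, real_inner_smul_left, real_inner_smul_right]
    ring
  have h2 : ‖w.re • p.2 + w.im • p.1‖ ^ 2
      = w.re ^ 2 * ‖p.2‖ ^ 2 + 2 * (w.re * w.im * inner ℝ p.1 p.2) + w.im ^ 2 * ‖p.1‖ ^ 2 := by
    rw [norm_add_sq_real, norm_smul, norm_smul, mul_pow, mul_pow, Real.norm_eq_abs,
      Real.norm_eq_abs, sq_abs, sq_abs, real_inner_smul_left, real_inner_smul_right,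
      real_inner_comm]
    ring
  apply Complex.ext
  · simp only [nn, csmul, h1, h2, sq, Complex.mul_re, Complex.mul_im]
    ring
  · simp only [nn, csmul, sq, Complex.mul_re, Complex.mul_im, inner_add_right, inner_sub_left,
      real_inner_smul_left, real_inner_smul_right, real_inner_self_eq_norm_sq,
      real_inner_comm p.1 p.2]
    ring

theorem nn_pinv (p : A × A) : nn (pinv p) = (nn p)⁻¹ := by
  rw [pinv, nn_csmul, nn_pconj]
  by_cases h : nn p = 0
  · simp [h]
  · field_simp

theorem pmul_pinv {p : A × A} (hp : nn p ≠ 0) : pmul p (pinv p) = (1, 0) := by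
  rw [pinv, pmul_csmul, pmul_pconj, csmul_csmul, inv_mul_cancel₀ hp, csmul_one]

theorem pinv_pmul {p : A × A} (hp : nn p ≠ 0) : pmul (pinv p) p = (1, 0) := by
  rw [pinv, csmul_pmul, pconj_pmul, csmul_csmul, inv_mul_cancel₀ hp, csmul_one]

theorem eq_pinv {p q : A × A} (hp : nn p ≠ 0) (h : pmul p q = (1, 0)) : q = pinv p := by
  have := pconj_pmul_pmul p q
  rw [h, pmul_one] at this
  rw [pinv, this, csmul_csmul, inv_mul_cancel₀ hp, csmul_one]

/-- Evaluation is not multiplicative in general, but it is for complex scalars on the left, because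
`J * (J * x) = -x`. -/
theorem ev_csmul (w : ℂ) (p : A × A) {J : A} (hJ : J ∈ imUnits A) :
    ev J (csmul w p) = pt w J * ev J p := by
  simp only [ev, csmul, pt, mul_add, add_mul, smul_mul_assoc, mul_mul_of_mem_imUnits hJ,
    one_mul, mul_smul_comm]
  module

theorem ev_one (J : A) : ev J ((1, 0) : A × A) = 1 := by simp [ev]

/-- Half the sum and half the difference of the values at two antipodal units recover both
components. -/
theorem eq_one_of_ev {p : A × A} {J : A} (hJ : J ∈ imUnits A) (h1 : ev J p = 1)
    (h2 : ev (-J) p = 1) : p = (1, 0) := by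
  simp only [ev, neg_mul] at h1 h2
  have h : J * p.2 = 0 := by
    linear_combination (norm := module) (1 / 2 : ℝ) • h1 - (1 / 2 : ℝ) • h2
  refine Prod.ext ?_ ?_
  · simpa [h] using h1
  · simpa [ne_zero_of_mem_imUnits hJ] using h

theorem ev_injective {p : A × A} (hp : p.2 ≠ 0) {J K : A} (h : ev J p = ev K p) : J = K := by
  simp only [ev, add_right_inj] at h
  rw [← mul_mul_cinv hp J, h, mul_mul_cinv hp]

/-- The squares contribute the real part of `nn p`; the two mixed terms `J p₂ᶜ p₁` and `J p₁ᶜ p₂`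
combine by polarisation into `2⟨p₁, p₂⟩ J`. The shape of `T_f` is read off from this identity. -/
theorem ev_pconj_mul (p : A × A) {J : A} (hJ : J ∈ imUnits A) :
    ev J (pconj p) * p.1 + (J * ev J (pconj p)) * p.2 = pt (nn p) J := by
  have h := mul_star_mul_add' p.1 p.2 J
  simp only [ev, pconj, nn, pt, mul_add, add_mul, mul_mul_of_mem_imUnits hJ, neg_mul,
    star_mul_self']
  linear_combination (norm := module) h

theorem ev_pconj_ne_zero {p : A × A} (hp : nn p ≠ 0) {J : A} (hJ : J ∈ imUnits A) :
    ev J (pconj p) ≠ 0 := by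
  intro h
  have := ev_pconj_mul p hJ
  rw [h, mul_zero, zero_mul, zero_mul, add_zero, eq_comm, pt_eq_zero_iff hJ] at this
  exact hp this

theorem ev_ne_zero {p : A × A} (hp : nn p ≠ 0) {J : A} (hJ : J ∈ imUnits A) : ev J p ≠ 0 := by
  simpa [pconj_pconj] using ev_pconj_ne_zero (p := pconj p) (by rwa [nn_pconj]) hJ

/-- The imaginary unit `(a⁻¹ ((J a) s)) s⁻¹`. -/
def twist (a s J : A) : A := (cinv a * ((J * a) * s)) * cinv s

/-- Up to a positive factor, the inner product with `1` is that of `(J a) s` with `a s`, hence a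
multiple of `⟨J, 1⟩ = 0`. The norm is `1` by multiplicativity. -/
theorem twist_mem_imUnits {a s J : A} (ha : a ≠ 0) (hs : s ≠ 0) (hJ : J ∈ imUnits A) :
    twist a s J ∈ imUnits A := by
  rw [mem_imUnits_iff, star_eq_neg_iff]
  constructor
  · rw [twist, cinv, cinv, mul_smul_comm, real_inner_smul_left, inner_mul_right, one_mul,
      star_star, smul_mul_assoc, real_inner_smul_left, inner_mul_left, star_star,
      inner_mul_mul_right]
    have := inner_mul_mul_right a J 1
    rw [one_mul, inner_one_of_mem_imUnits hJ, mul_zero] at this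
    rw [this]
    simp
  · rw [twist, norm_mul', norm_mul', norm_mul', norm_mul', norm_cinv, norm_cinv,
      norm_of_mem_imUnits hJ]
    have := norm_ne_zero_iff.2 ha
    have := norm_ne_zero_iff.2 hs
    field_simp

theorem transf_pt_eq {a s J : A} (ha : a ≠ 0) (hs : s ≠ 0) (z : ℂ) :
    (cinv a * ((pt z J * a) * s)) * cinv s = pt z (twist a s J) := by
  simp only [pt, twist, add_mul, mul_add, smul_mul_assoc, mul_smul_comm, one_mul,
    cinv_mul_mul ha, mul_cinv' hs]

/-- With `a = ev J (pconj p)` and `K` the twisted unit, `K p₂ = a⁻¹ ((J a) p₂)`, since `s⁻¹` cancels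
against `p₂ = r s`. Thus `ev K p` is `a⁻¹` times the left side of `ev_pconj_mul`. The scalar `r` may
vanish, which covers real points. -/
theorem cinv_ev_twist {p : A × A} (hp : nn p ≠ 0) {J s : A} (hJ : J ∈ imUnits A) (hs : s ≠ 0)
    {r : ℝ} (h : p.2 = r • s) :
    cinv (ev (twist (ev J (pconj p)) s J) p) = ev J (pinv p) := by
  have ha := ev_pconj_ne_zero hp hJ
  have h1 : ev (twist (ev J (pconj p)) s J) p = cinv (ev J (pconj p)) * pt (nn p) J := by
    rw [← ev_pconj_mul p hJ, mul_add, cinv_mul_mul ha, ev, h, mul_smul_comm, twist,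
      mul_cinv_mul' hs, mul_smul_comm, mul_smul_comm]
  -- For fixed `J` the points `pt w J` multiply like the complex numbers `w`, by two uses of
  -- `ev_csmul`.
  have h2 : pt (nn p)⁻¹ J = cinv (pt (nn p) J) := by
    apply eq_cinv_of_mul_eq_one
    have := ev_csmul (nn p) (csmul (nn p)⁻¹ (1, 0)) hJ
    rw [csmul_csmul, mul_inv_cancel₀ hp, csmul_one, ev_one, ev_csmul _ _ hJ, ev_one, mul_one]
      at this
    exact this.symm
  rw [h1, cinv_mul, cinv_cinv ha, pinv, ev_csmul _ _ hJ, h2]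

end Pairs

/-! ### Slice functions, reciprocals and the transformation on spheres -/

section Slice

set_option linter.unusedSectionVars false

variable {A : Type*} [NormedAddCommGroup A] [InnerProductSpace ℝ A] [Mul A] [One A] [Star A]
  [CompAlg A]

theorem slice_pt_eq_ev (hA : IsCHO A) {D : Set ℂ} {F : ℂ → A × A} (hF : IsStem D F) {z : ℂ}
    (hz : z ∈ D) {J : A} (hJ : J ∈ imUnits A) : slice F (pt z J) = ev J (F z) :=
  slice_pt hA hF hz hJ

theorem IsStem.mono {D E : Set ℂ} {F : ℂ → A × A} (hF : IsStem D F) (h : E ⊆ D) : IsStem E F :=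
  fun z hz => hF z (h hz)

theorem IsStem.conj {D : Set ℂ} {F : ℂ → A × A} (hF : IsStem D F) : IsStem D (stemConj F) :=
  fun z hz => by
    simp only [stemConj, (hF z hz).1, (hF z hz).2, star_neg, and_self]

theorem IsStem.mul {D : Set ℂ} {F G : ℂ → A × A} (hF : IsStem D F) (hG : IsStem D G) :
    IsStem D (stemMul F G) :=
  fun z hz => by
    simp only [stemMul, (hF z hz).1, (hF z hz).2, (hG z hz).1, (hG z hz).2, neg_mul, mul_neg,
      neg_neg, neg_add, and_self]

theorem IsStem.snd_eq_zero {D : Set ℂ} {F : ℂ → A × A} (hF : IsStem D F) {z : ℂ} (hz : z ∈ D)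
    (h : z.im = 0) : (F z).2 = 0 := by
  have h1 : star z = z := Complex.conj_eq_iff_im.2 h
  have := (hF z hz).2
  rw [h1] at this
  have h2 : (2 : ℝ) • (F z).2 = 0 := by rw [two_smul]; exact eq_neg_iff_add_eq_zero.1 this
  simpa using h2

theorem IsStem.nn_star {D : Set ℂ} {F : ℂ → A × A} (hF : IsStem D F) {z : ℂ} (hz : z ∈ D) :
    nn (F (star z)) = star (nn (F z)) := by
  rw [nn, (hF z hz).1, (hF z hz).2]
  apply Complex.ext <;> simp [nn]

/-- The set of all `z ∈ D` where the stem function `F Fᶜ` of `N(f)` does not vanish. -/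
def regularSet (D : Set ℂ) (F : ℂ → A × A) : Set ℂ := {z | z ∈ D ∧ nn (F z) ≠ 0}

theorem regularSet_subset (D : Set ℂ) (F : ℂ → A × A) : regularSet D F ⊆ D := fun _ h => h.1

theorem star_mem_regularSet {D : Set ℂ} (hD : ∀ z ∈ D, star z ∈ D) {F : ℂ → A × A}
    (hF : IsStem D F) : ∀ z ∈ regularSet D F, star z ∈ regularSet D F :=
  fun z hz => ⟨hD z hz.1, by rw [hF.nn_star hz.1, Ne, star_eq_zero]; exact hz.2⟩

theorem pt_mem_circ_iff {D : Set ℂ} (hD : ∀ z ∈ D, star z ∈ D) {z : ℂ} {J : A}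
    (hJ : J ∈ imUnits A) : pt z J ∈ circ A D ↔ z ∈ D := by
  refine ⟨?_, fun h => ⟨z, h, J, hJ, rfl⟩⟩
  rintro ⟨w, hw, I, hI, h⟩
  rcases pt_eq_pt hJ hI h with rfl | rfl
  · exact hw
  · simpa using hD _ hw

theorem trace_circ {D : Set ℂ} (hD : ∀ z ∈ D, star z ∈ D) : trace (circ A D) = D := by
  ext z
  constructor
  · rintro ⟨J, hJ, h⟩
    exact (pt_mem_circ_iff hD hJ).1 h
  · intro h
    obtain ⟨J, hJ⟩ := exists_mem_imUnits A
    exact ⟨J, hJ, z, h, J, hJ, rfl⟩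

theorem normal_pt (hA : IsCHO A) {D : Set ℂ} {F : ℂ → A × A} (hF : IsStem D F) {z : ℂ}
    (hz : z ∈ D) {J : A} (hJ : J ∈ imUnits A) : normal F (pt z J) = pt (nn (F z)) J := by
  rw [normal, sliceMul, slice_pt_eq_ev hA (hF.mul hF.conj) hz hJ, stemMul_apply, stemConj_apply,
    pmul_pconj, ev_csmul _ _ hJ, ev_one, mul_one]

theorem omega1_eq (hA : IsCHO A) {D : Set ℂ} {F : ℂ → A × A} (hF : IsStem D F) :
    Omega1 D F = circ A (regularSet D F) := by
  ext x
  constructor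
  · rintro ⟨⟨z, hz, J, hJ, rfl⟩, h⟩
    rw [normal_pt hA hF hz hJ, Ne, pt_eq_zero_iff hJ] at h
    exact ⟨z, ⟨hz, h⟩, J, hJ, rfl⟩
  · rintro ⟨z, ⟨hz, h⟩, J, hJ, rfl⟩
    refine ⟨⟨z, hz, J, hJ, rfl⟩, ?_⟩
    rwa [normal_pt hA hF hz hJ, Ne, pt_eq_zero_iff hJ]

theorem trace_omega1 (hA : IsCHO A) {D : Set ℂ} (hD : ∀ z ∈ D, star z ∈ D) {F : ℂ → A × A}
    (hF : IsStem D F) : trace (Omega1 D F) = regularSet D F := by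
  rw [omega1_eq hA hF, trace_circ (star_mem_regularSet hD hF)]

theorem sphDeriv_pt (hA : IsCHO A) {D : Set ℂ} {F : ℂ → A × A}
    (hF : IsStem D F) {z : ℂ} (hz : z ∈ D) {J : A} (hJ : J ∈ imUnits A) :
    sphDeriv F (pt z J) = z.im⁻¹ • (F z).2 := by
  have hJ0 := ne_zero_of_mem_imUnits hJ
  rw [sphDeriv, star_pt z hJ, ← pt_neg, slice_pt_eq_ev hA hF hz hJ,
    slice_pt_eq_ev hA hF hz (neg_mem_imUnits hJ), im_pt z hJ, cinv_smul]
  have : ev J (F z) - ev (-J) (F z) = (2 : ℝ) • (J * (F z).2) := by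
    simp only [ev, neg_mul]
    module
  rw [this, smul_mul_assoc, mul_smul_comm, cinv_mul_mul hJ0]
  module

theorem sph_pt {z : ℂ} {I : A} (hI : I ∈ imUnits A) :
    sph (pt z I) = {x | ∃ J ∈ imUnits A, x = pt z J} := by
  ext x
  constructor
  · rintro ⟨w, K, hK, J, hJ, h, rfl⟩
    rcases pt_eq_pt hI hK h with rfl | rfl
    · exact ⟨J, hJ, rfl⟩
    · exact ⟨-J, neg_mem_imUnits hJ, by rw [← pt_neg]⟩
  · rintro ⟨J, hJ, rfl⟩
    exact ⟨z, I, hI, J, hJ, rfl, rfl⟩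

/-- The stem functions `F` and `G` are reciprocal on the conjugation-invariant set `E`. -/
structure Recip (E : Set ℂ) (F G : ℂ → A × A) : Prop where
  star_mem : ∀ z ∈ E, star z ∈ E
  left : IsStem E F
  right : IsStem E G
  nn_ne : ∀ z ∈ E, nn (F z) ≠ 0
  eq_pinv : ∀ z ∈ E, G z = pinv (F z)

namespace Recip

variable {E : Set ℂ} {F G : ℂ → A × A}

theorem pmul_eq (R : Recip E F G) {z : ℂ} (hz : z ∈ E) : pmul (F z) (G z) = (1, 0) := by
  rw [R.eq_pinv z hz, pmul_pinv (R.nn_ne z hz)]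

theorem pmul_eq' (R : Recip E F G) {z : ℂ} (hz : z ∈ E) : pmul (G z) (F z) = (1, 0) := by
  rw [R.eq_pinv z hz, pinv_pmul (R.nn_ne z hz)]

theorem nn_right_ne (R : Recip E F G) {z : ℂ} (hz : z ∈ E) : nn (G z) ≠ 0 := by
  rw [R.eq_pinv z hz, nn_pinv]
  exact inv_ne_zero (R.nn_ne z hz)

/-- The inverse in `A ⊗ ℂ` is two-sided and `nn` of the inverse is the inverse of `nn`; so each
result on `T_f` holds for `T_g` as well. -/
theorem symm (R : Recip E F G) : Recip E G F :=
  ⟨R.star_mem, R.right, R.left, fun _ hz => R.nn_right_ne hz,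
    fun _ hz => SliceFun.eq_pinv (R.nn_right_ne hz) (R.pmul_eq' hz)⟩

/-- If `F₂ = 0`, the product relation reduces to `F₁ G₁ = 1` and `F₁ G₂ = 0`, and there are no zero
divisors. -/
theorem snd_eq_zero_of (R : Recip E F G) {z : ℂ} (hz : z ∈ E) (h : (F z).2 = 0) :
    (G z).2 = 0 := by
  have h1 := congrArg Prod.fst (R.pmul_eq hz)
  have h2 := congrArg Prod.snd (R.pmul_eq hz)
  simp only [pmul, h, zero_mul, sub_zero, add_zero] at h1 h2
  rcases mul_eq_zero.1 h2 with h3 | h3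
  · simp [h3] at h1
  · exact h3

theorem snd_eq_zero_iff (R : Recip E F G) {z : ℂ} (hz : z ∈ E) : (G z).2 = 0 ↔ (F z).2 = 0 :=
  ⟨R.symm.snd_eq_zero_of hz, R.snd_eq_zero_of hz⟩

theorem fst_eq_cinv (R : Recip E F G) {z : ℂ} (hz : z ∈ E) (h : (F z).2 = 0) :
    (G z).1 = cinv (F z).1 := by
  have h1 := congrArg Prod.fst (R.pmul_eq hz)
  simp only [pmul, h, zero_mul, sub_zero] at h1
  exact eq_cinv_of_mul_eq_one h1

end Recip

/-- A slice function equal to `1` at the two antipodal points `pt z J` and `pt z (-J)` has stem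
value `(1, 0)` at `z`, so the inverse can be computed pointwise in `A ⊗ ℂ`. -/
theorem isReciprocal_iff (hA : IsCHO A) {E : Set ℂ} (hE : ∀ z ∈ E, star z ∈ E)
    {F G : ℂ → A × A} (hF : IsStem E F) (hn : ∀ z ∈ E, nn (F z) ≠ 0) :
    IsReciprocal E F G ↔ Recip E F G := by
  constructor
  · rintro ⟨hG, h⟩
    refine ⟨hE, hF, hG, hn, fun z hz => eq_pinv (hn z hz) ?_⟩
    have key (J : A) (hJ : J ∈ imUnits A) : ev J (pmul (F z) (G z)) = 1 := by
      rw [← (h (pt z J) ⟨z, hz, J, hJ, rfl⟩).1, sliceMul, slice_pt_eq_ev hA (hF.mul hG) hz hJ,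
        stemMul_apply]
    obtain ⟨J, hJ⟩ := exists_mem_imUnits A
    exact eq_one_of_ev hJ (key J hJ) (key _ (neg_mem_imUnits hJ))
  · intro R
    refine ⟨R.right, ?_⟩
    rintro x ⟨z, hz, J, hJ, rfl⟩
    rw [sliceMul, sliceMul, slice_pt_eq_ev hA (R.left.mul R.right) hz hJ,
      slice_pt_eq_ev hA (R.right.mul R.left) hz hJ, stemMul_apply, stemMul_apply, R.pmul_eq hz,
      R.pmul_eq' hz, ev_one]
    simp

theorem isStem_pinv {E : Set ℂ} {F : ℂ → A × A} (hF : IsStem E F) :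
    IsStem E (fun z => pinv (F z)) := by
  intro z hz
  have h : nn (F (star z)) = star (nn (F z)) := hF.nn_star hz
  simp only [pinv, pconj, csmul, h, (hF z hz).1, (hF z hz).2]
  rw [← star_inv₀]
  constructor
  all_goals
    simp only [Complex.star_def, Complex.conj_re, Complex.conj_im, star_neg]
    module

theorem recip_pinv {E : Set ℂ} (hE : ∀ z ∈ E, star z ∈ E) {F : ℂ → A × A} (hF : IsStem E F)
    (hn : ∀ z ∈ E, nn (F z) ≠ 0) : Recip E F (fun z => pinv (F z)) :=
  ⟨hE, hF, isStem_pinv hF, hn, fun _ _ => rfl⟩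

/-- `s` is a spherical derivative of `f = I(F)` on `Ω_E`, with arbitrary values on the real line. -/
def IsSphDeriv (E : Set ℂ) (F : ℂ → A × A) (s : A → A) : Prop :=
  ∀ z ∈ E, ∀ J ∈ imUnits A, (F z).2 = z.im • s (pt z J)

/-- The set of all `x ∈ Ω_E` with `s x ≠ 0`. -/
def support (E : Set ℂ) (s : A → A) : Set A := {x | x ∈ circ A E ∧ s x ≠ 0}

theorem IsSphDeriv.ne_zero {E : Set ℂ} {F : ℂ → A × A} {s : A → A} (hs : IsSphDeriv E F s) {z : ℂ}
    (hz : z ∈ E) {J K : A} (hJ : J ∈ imUnits A) (hK : K ∈ imUnits A) (h : s (pt z J) ≠ 0) :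
    s (pt z K) ≠ 0 := by
  by_cases him : z.im = 0
  · rwa [pt_eq_of_im_eq_zero him, ← pt_eq_of_im_eq_zero him J]
  · intro h0
    have := hs z hz J hJ
    rw [hs z hz K hK, h0, smul_zero, eq_comm, smul_eq_zero] at this
    tauto

/-- The transformation moves only the imaginary unit, by `twist`. This pointwise form gives
invariance of spheres, the formula for the reciprocal and, used twice, the inverse map. -/
theorem Recip.transf_pt (hA : IsCHO A) {E : Set ℂ} {F G : ℂ → A × A} {s : A → A}
    (R : Recip E F G) (hs : IsSphDeriv E F s) {z : ℂ} (hz : z ∈ E) {J : A} (hJ : J ∈ imUnits A)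
    (h : s (pt z J) ≠ 0) :
    ∃ K ∈ imUnits A, transf F s (pt z J) = pt z K ∧ cinv (ev K (F z)) = ev J (G z) := by
  have hn := R.nn_ne z hz
  have ha := ev_pconj_ne_zero hn hJ
  refine ⟨_, twist_mem_imUnits ha h hJ, ?_, ?_⟩
  · rw [transf, sliceConj, slice_pt_eq_ev hA R.left.conj hz hJ, stemConj_apply,
      transf_pt_eq ha h]
  · rw [cinv_ev_twist hn hJ h (hs z hz J hJ), R.eq_pinv z hz]

section Transf

variable (hA : IsCHO A) {E : Set ℂ} {F G : ℂ → A × A} {s t : A → A} (R : Recip E F G)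
  (hs : IsSphDeriv E F s)

include hA R hs

theorem Recip.slice_eq {x : A} (hx : x ∈ support E s) :
    slice G x = cinv (slice F (transf F s x)) := by
  obtain ⟨⟨z, hz, J, hJ, rfl⟩, h⟩ := hx
  obtain ⟨K, hK, h1, h2⟩ := R.transf_pt hA hs hz hJ h
  rw [h1, slice_pt_eq_ev hA R.right hz hJ, slice_pt_eq_ev hA R.left hz hK, h2]

theorem Recip.mapsTo : Set.MapsTo (transf F s) (support E s) (support E s) := by
  rintro x ⟨⟨z, hz, J, hJ, rfl⟩, h⟩
  obtain ⟨K, hK, h1, h2⟩ := R.transf_pt hA hs hz hJ h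
  rw [h1]
  exact ⟨⟨z, hz, K, hK, rfl⟩, hs.ne_zero hz hJ hK h⟩

/-- From `g(x) = f(T_f x)⁻¹` and `f(T_f x) = g(T_g (T_f x))⁻¹` one gets `g(x) = g(T_g (T_f x))`.
Both arguments lie on one sphere, where `g` is injective if `G₂ ≠ 0`. -/
theorem Recip.leftInvOn (ht : IsSphDeriv E G t) (hst : support E s = support E t) :
    Set.LeftInvOn (transf G t) (transf F s) (support E s) := by
  intro x hx
  have hx' := R.mapsTo hA hs hx
  rw [hst] at hx'
  obtain ⟨⟨z, hz, J, hJ, rfl⟩, h⟩ := hx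
  obtain ⟨K, hK, h1, h2⟩ := R.transf_pt hA hs hz hJ h
  rw [h1] at hx' ⊢
  obtain ⟨J', hJ', h3, h4⟩ := R.symm.transf_pt hA ht hz hK hx'.2
  rw [h3]
  -- On the real axis injectivity is unavailable but also unnecessary: the sphere is a single point.
  by_cases him : z.im = 0
  · rw [pt_eq_of_im_eq_zero him, pt_eq_of_im_eq_zero him]
  · have hF2 : (F z).2 ≠ 0 := by
      rw [hs z hz J hJ]
      exact smul_ne_zero him h
    have hG2 : (G z).2 ≠ 0 := by rwa [Ne, R.snd_eq_zero_iff hz]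
    have hne := ev_ne_zero (R.nn_right_ne hz) hJ'
    rw [← h4, cinv_cinv hne] at h2
    rw [ev_injective hG2 h2]

theorem Recip.invOn (ht : IsSphDeriv E G t) (hst : support E s = support E t) :
    Set.InvOn (transf G t) (transf F s) (support E s) (support E s) := by
  refine ⟨R.leftInvOn hA hs ht hst, ?_⟩
  rw [hst]
  exact R.symm.leftInvOn hA ht hs hst.symm

theorem Recip.bijOn (ht : IsSphDeriv E G t) (hst : support E s = support E t) :
    Set.BijOn (transf F s) (support E s) (support E s) := by
  refine (R.invOn hA hs ht hst).bijOn (R.mapsTo hA hs) ?_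
  rw [hst]
  exact R.symm.mapsTo hA ht

end Transf

/-- The spherical derivative, extended by zero to the real line. -/
def sphDerivZero (F : ℂ → A × A) (x : A) : A := open Classical in
  if IsReal x then 0 else sphDeriv F x

theorem isSphDeriv_sphDerivZero (hA : IsCHO A) {E : Set ℂ} {F : ℂ → A × A} (hF : IsStem E F) :
    IsSphDeriv E F (sphDerivZero F) := by
  intro z hz J hJ
  by_cases him : z.im = 0
  · rw [hF.snd_eq_zero hz him, him, zero_smul]
  · rw [sphDerivZero, if_neg (by rwa [isReal_pt_iff hJ]), sphDeriv_pt hA hF hz hJ, smul_smul,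
      mul_inv_cancel₀ him, one_smul]

/-- Extending `f'_s` by zero makes the support exclude the real line by itself, so the general
results on `transf` apply. -/
theorem omega2_eq_support (hA : IsCHO A) {D : Set ℂ} {F : ℂ → A × A} (hF : IsStem D F) :
    Omega2 D F = support (regularSet D F) (sphDerivZero F) := by
  ext x
  rw [Omega2, omega1_eq hA hF, support, Set.mem_ofPred_eq, Set.mem_ofPred_eq, sphDerivZero]
  by_cases h : IsReal x <;> simp [h]

theorem transf_sphDerivZero (F : ℂ → A × A) {x : A} (hx : ¬ IsReal x) :
    transf F (sphDerivZero F) x = T F x := by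
  simp only [T, transf, sphDerivZero, if_neg hx]

theorem not_isReal_of_mem_support {E : Set ℂ} {F : ℂ → A × A} {x : A}
    (hx : x ∈ support E (sphDerivZero F)) : ¬ IsReal x := by
  intro h
  exact hx.2 (by rw [sphDerivZero, if_pos h])

theorem pt_mem_support_iff (hA : IsCHO A) {E : Set ℂ} (hE : ∀ z ∈ E, star z ∈ E) {F : ℂ → A × A}
    (hF : IsStem E F) {z : ℂ} {J : A} (hJ : J ∈ imUnits A) :
    pt z J ∈ support E (sphDerivZero F) ↔ z ∈ E ∧ (F z).2 ≠ 0 := by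
  rw [support, Set.mem_ofPred_eq, pt_mem_circ_iff hE hJ]
  refine and_congr_right fun hz => ?_
  rw [isSphDeriv_sphDerivZero hA hF z hz J hJ]
  by_cases him : z.im = 0
  · simp [him, sphDerivZero, isReal_pt_iff hJ]
  · simp [him]

theorem Recip.support_eq (hA : IsCHO A) {E : Set ℂ} {F G : ℂ → A × A} (R : Recip E F G) :
    support E (sphDerivZero F) = support E (sphDerivZero G) := by
  ext x
  obtain ⟨J, hJ, hx⟩ := exists_pt x
  rw [hx, pt_mem_support_iff hA R.star_mem R.left hJ, pt_mem_support_iff hA R.star_mem R.right hJ]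
  exact and_congr_right fun hz => not_congr (R.snd_eq_zero_iff hz).symm

end Slice

/-! ### Conformality on spheres and continuity -/

section Calculus

set_option linter.unusedSectionVars false

variable {A : Type*} [NormedAddCommGroup A] [InnerProductSpace ℝ A] [Mul A] [One A] [Star A]
  [CompAlg A]

variable (A) in
/-- The multiplication as a continuous bilinear map. -/
def mulL : A →L[ℝ] A →L[ℝ] A :=
  (LinearMap.mul ℝ A).mkContinuous₂ 1 fun x y => by simp [norm_mul']

theorem mulL_apply (x y : A) : mulL A x y = x * y := rfl

variable (A) in
/-- The `*`-involution as a linear isometry. -/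
def starL' : A →ₗᵢ[ℝ] A where
  toFun := star
  map_add' := star_add
  map_smul' r x := by simp
  norm_map' := norm_star'

theorem starL'_apply (x : A) : starL' A x = star x := rfl

instance CompAlg.continuousMul : ContinuousMul A :=
  ⟨(mulL A).continuous₂⟩

instance CompAlg.continuousStar : ContinuousStar A := ⟨(starL' A).continuous⟩

variable {E : Type*} [NormedAddCommGroup E] [NormedSpace ℝ E] {n : WithTop ℕ∞} {f g : E → A}
  {x : E}

theorem contDiffAt_mul (hf : ContDiffAt ℝ n f x) (hg : ContDiffAt ℝ n g x) :
    ContDiffAt ℝ n (fun y => f y * g y) x :=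
  (mulL A).isBoundedBilinearMap.contDiff.contDiffAt.comp x (hf.prodMk hg)

theorem contDiffAt_star (hf : ContDiffAt ℝ n f x) : ContDiffAt ℝ n (fun y => star (f y)) x :=
  (starL' A).contDiff.contDiffAt.comp x hf

theorem contDiffAt_cinv (hf : ContDiffAt ℝ n f x) (h : f x ≠ 0) :
    ContDiffAt ℝ n (fun y => cinv (f y)) x :=
  ((hf.norm_sq ℝ).inv (pow_ne_zero 2 (norm_ne_zero_iff.2 h))).smul (contDiffAt_star hf)

theorem continuousOn_cinv {X : Type*} [TopologicalSpace X] {f : X → A} {U : Set X}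
    (hf : ContinuousOn f U) (h : ∀ x ∈ U, f x ≠ 0) : ContinuousOn (fun x => cinv (f x)) U :=
  ((hf.norm.pow 2).inv₀ fun x hx => pow_ne_zero 2 (norm_ne_zero_iff.2 (h x hx))).smul hf.star

/-- The algebraic inverse is the inversion in the unit sphere followed by the linear isometry
`star`. -/
theorem conformalAt_cinv {x : A} (hx : x ≠ 0) : ConformalAt (cinv : A → A) x := by
  have h1 := EuclideanGeometry.hasFDerivAt_inversion (c := (0 : A)) (R := 1) hx
  have h2 := (starL' A).toContinuousLinearMap.hasFDerivAt.comp x h1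
  have h3 : (cinv : A → A) = (starL' A).toContinuousLinearMap ∘ EuclideanGeometry.inversion 0 1 := by
    ext y
    simp [EuclideanGeometry.inversion, cinv, starL'_apply]
  rw [h3]
  refine ⟨_, h2, ?_⟩
  rw [isConformalMap_iff]
  -- The differential of the inversion is a reflection scaled by `(1 / dist x 0) ^ 2`; inner
  -- products scale by its square.
  refine ⟨((1 / dist x 0) ^ 2) ^ 2, ?_, fun u v => ?_⟩
  · have := dist_pos.2 hx
    positivity
  · simp [starL'_apply, inner_star_star, real_inner_smul_left, real_inner_smul_right]
    ring

theorem conformalAt_affine (a b : A) {d : A} (hd : d ≠ 0) {c : ℝ} (hc : c ≠ 0) (x : A) :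
    ConformalAt (fun x => a + c • ((x - b) * d)) x := by
  have h : HasFDerivAt (fun x => a + c • ((x - b) * d)) (c • (mulL A).flip d) x := by
    have h1 : HasFDerivAt (fun x : A => x - b) (ContinuousLinearMap.id ℝ A) x :=
      (hasFDerivAt_id x).sub_const b
    have h2 := (((mulL A).flip d).hasFDerivAt.comp x h1).const_smul c
    exact h2.const_add a
  refine ⟨_, h, ?_⟩
  rw [isConformalMap_iff]
  refine ⟨c ^ 2 * ‖d‖ ^ 2, ?_, fun u v => ?_⟩
  · have := norm_pos_iff.2 hd
    positivity
  · simp only [_root_.smul_apply, ContinuousLinearMap.flip_apply, mulL_apply,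
      real_inner_smul_left, real_inner_smul_right, inner_mul_mul_right]
    ring

theorem contDiffAt_affine (a b d : A) (c : ℝ) (x : A) :
    ContDiffAt ℝ n (fun x => a + c • ((x - b) * d)) x :=
  contDiffAt_const.add ((contDiffAt_mul (contDiffAt_id.sub contDiffAt_const)
    contDiffAt_const).const_smul c)

/-- On the sphere the relation `g = inv ∘ f ∘ T_f` can be solved for `T_f`. Replacing `f⁻¹` and `g`
by affine maps of `A` gives an extension of `T_f` that is conformal near the sphere, so no calculus
on the sphere is needed. -/
theorem Recip.exists_conformal (hA : IsCHO A) {E : Set ℂ} {F G : ℂ → A × A} (R : Recip E F G)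
    {z : ℂ} (hz : z ∈ E) (him : z.im ≠ 0) (h2 : (F z).2 ≠ 0) :
    ∃ S : A → A, (∀ J ∈ imUnits A, T F (pt z J) = S (pt z J)) ∧
      ∀ J ∈ imUnits A, ConformalAt S (pt z J) ∧ ContDiffAt ℝ ∞ S (pt z J) := by
  have hG2 : (G z).2 ≠ 0 := by rwa [Ne, R.snd_eq_zero_iff hz]
  -- On the sphere of `z`, `u` agrees with `g`, while `v` below inverts `f`: both come from solving
  -- `x = α + βJ` for `J`.
  set u : A → A := fun x => (G z).1 + z.im⁻¹ • ((x - z.re • (1 : A)) * (G z).2) with hu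
  set v : A → A := fun x => z.re • (1 : A) + z.im • ((x - (F z).1) * cinv (F z).2) with hv
  have hu' (J : A) : u (pt z J) = ev J (G z) := by
    rw [hu]
    simp only [pt, add_sub_cancel_left, ev, smul_mul_assoc, smul_smul, inv_mul_cancel₀ him,
      one_smul]
  have hne (J : A) (hJ : J ∈ imUnits A) : u (pt z J) ≠ 0 := by
    rw [hu']
    exact ev_ne_zero (R.nn_right_ne hz) hJ
  refine ⟨fun x => v (cinv (u x)), fun J hJ => ?_, fun J hJ => ⟨?_, ?_⟩⟩
  · have hx : pt z J ∈ support E (sphDerivZero F) :=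
      (pt_mem_support_iff hA R.star_mem R.left hJ).2 ⟨hz, h2⟩
    obtain ⟨K, hK, h3, h4⟩ := R.transf_pt hA (isSphDeriv_sphDerivZero hA R.left) hz hJ hx.2
    change _ = v (cinv (u (pt z J)))
    rw [← transf_sphDerivZero F (not_isReal_of_mem_support hx), h3, hu', ← h4,
      cinv_cinv (ev_ne_zero (R.nn_ne z hz) hK), hv]
    simp only [ev, add_sub_cancel_left, mul_mul_cinv h2, pt]
  · exact (conformalAt_affine _ _ (cinv_ne_zero h2) him _).comp (pt z J)
      ((conformalAt_cinv (hne J hJ)).comp (pt z J)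
        (conformalAt_affine _ _ hG2 (inv_ne_zero him) _))
  · exact (contDiffAt_affine _ _ _ _ _).comp (pt z J)
      (contDiffAt_cinv (contDiffAt_affine _ _ _ _ _) (hne J hJ))

theorem Recip.isConformalOnSph (hA : IsCHO A) {E : Set ℂ} {F G : ℂ → A × A} (R : Recip E F G)
    {y : A} (hy : y ∈ support E (sphDerivZero F)) : IsConformalOnSph (T F) y := by
  obtain ⟨I, hI, hyI⟩ := exists_pt y
  set z : ℂ := ⟨re y, ‖im y‖⟩
  rw [hyI] at hy ⊢
  have hr := not_isReal_of_mem_support hy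
  obtain ⟨hz, h2⟩ := (pt_mem_support_iff hA R.star_mem R.left hI).1 hy
  have him : z.im ≠ 0 := by rwa [isReal_pt_iff hI] at hr
  have hG2 : (G z).2 ≠ 0 := by rwa [Ne, R.snd_eq_zero_iff hz]
  have hs := isSphDeriv_sphDerivZero hA R.left
  have ht := isSphDeriv_sphDerivZero hA R.right
  have hF (J : A) (hJ : J ∈ imUnits A) : pt z J ∈ support E (sphDerivZero F) :=
    (pt_mem_support_iff hA R.star_mem R.left hJ).2 ⟨hz, h2⟩
  have hG (J : A) (hJ : J ∈ imUnits A) : pt z J ∈ support E (sphDerivZero G) :=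
    (pt_mem_support_iff hA R.star_mem R.right hJ).2 ⟨hz, hG2⟩
  have hTF (J : A) (hJ : J ∈ imUnits A) : T F (pt z J) = transf F (sphDerivZero F) (pt z J) :=
    (transf_sphDerivZero F (not_isReal_of_mem_support (hF J hJ))).symm
  have hTG (J : A) (hJ : J ∈ imUnits A) : T G (pt z J) = transf G (sphDerivZero G) (pt z J) :=
    (transf_sphDerivZero G (not_isReal_of_mem_support (hG J hJ))).symm
  have mF : Set.MapsTo (T F) (sph (pt z I)) (sph (pt z I)) := by
    rw [sph_pt hI]
    rintro x ⟨J, hJ, rfl⟩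
    obtain ⟨K, hK, h3, -⟩ := R.transf_pt hA hs hz hJ (hF J hJ).2
    exact ⟨K, hK, by rw [hTF J hJ, h3]⟩
  have mG : Set.MapsTo (T G) (sph (pt z I)) (sph (pt z I)) := by
    rw [sph_pt hI]
    rintro x ⟨J, hJ, rfl⟩
    obtain ⟨K, hK, h3, -⟩ := R.symm.transf_pt hA ht hz hJ (hG J hJ).2
    exact ⟨K, hK, by rw [hTG J hJ, h3]⟩
  have inv := R.invOn hA hs ht (R.support_eq hA)
  have hinv : Set.InvOn (T G) (T F) (sph (pt z I)) (sph (pt z I)) := by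
    rw [sph_pt hI] at mF mG ⊢
    constructor
    · rintro x ⟨J, hJ, rfl⟩
      obtain ⟨K, hK, h3⟩ := mF ⟨J, hJ, rfl⟩
      have := inv.1 (hF J hJ)
      rwa [← hTF J hJ, h3, ← hTG K hK, ← h3] at this
    · rintro x ⟨J, hJ, rfl⟩
      obtain ⟨K, hK, h3⟩ := mG ⟨J, hJ, rfl⟩
      have := inv.2 (hF J hJ)
      rwa [← hTG J hJ, h3, ← hTF K hK, ← h3] at this
  obtain ⟨S, hS1, hS2⟩ := R.exists_conformal hA hz him h2
  obtain ⟨S', hS1', hS2'⟩ := R.symm.exists_conformal hA hz him hG2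
  rw [IsConformalOnSph]
  refine ⟨hinv.bijOn mF mG, ?_, ⟨T G, hinv, ?_⟩, ?_⟩
  · rw [sph_pt hI]
    rintro x ⟨J, hJ, rfl⟩
    refine (hS2 J hJ).2.contDiffWithinAt.congr ?_ (hS1 J hJ)
    rintro x ⟨K, hK, rfl⟩
    exact hS1 K hK
  · rw [sph_pt hI]
    rintro x ⟨J, hJ, rfl⟩
    refine (hS2' J hJ).2.contDiffWithinAt.congr ?_ (hS1' J hJ)
    rintro x ⟨K, hK, rfl⟩
    exact hS1' K hK
  · rw [sph_pt hI]
    rintro x ⟨J, hJ, rfl⟩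
    obtain ⟨L, hL, hc⟩ := (hS2 J hJ).1
    obtain ⟨c, hc, h⟩ := (isConformalMap_iff L).1 hc
    refine ⟨L, hL.hasFDerivWithinAt.congr ?_ (hS1 J hJ), c, hc, fun v w _ _ => h v w⟩
    rintro x ⟨K, hK, rfl⟩
    exact hS1 K hK

/-- The point `α + βi` of the upper half-plane with `x = α + βJ`. -/
def toUpper (x : A) : ℂ := ⟨re x, ‖im x‖⟩

theorem continuous_re : Continuous (re : A → ℝ) := continuous_id.inner continuous_const

theorem continuous_im : Continuous (im : A → A) :=
  (continuous_id.sub continuous_star).const_smul _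

theorem continuous_toUpper : Continuous (toUpper : A → ℂ) :=
  Complex.equivRealProdCLM.symm.continuous.comp (continuous_re.prodMk continuous_im.norm)

theorem toUpper_mem {E : Set ℂ} (hE : ∀ z ∈ E, star z ∈ E) {x : A} (hx : x ∈ circ A E) :
    toUpper x ∈ E := by
  obtain ⟨J, hJ, h⟩ := exists_pt x
  rw [h] at hx
  exact (pt_mem_circ_iff hE hJ).1 hx

theorem isReal_iff {x : A} : IsReal x ↔ im x = 0 := by
  obtain ⟨J, hJ, h⟩ := exists_pt x
  rw [h, isReal_pt_iff hJ, im_pt _ hJ, smul_eq_zero]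
  simp [ne_zero_of_mem_imUnits hJ]

theorem sphDeriv_eq (hA : IsCHO A) {E : Set ℂ} (hE : ∀ z ∈ E, star z ∈ E) {F : ℂ → A × A}
    (hF : IsStem E F) {x : A} (hx : x ∈ circ A E) :
    sphDeriv F x = ‖im x‖⁻¹ • (F (toUpper x)).2 := by
  obtain ⟨J, hJ, h⟩ := exists_pt x
  have := sphDeriv_pt hA hF (toUpper_mem hE hx) hJ
  rwa [toUpper, ← h] at this

/-- Real points are left out because the unit `im x / ‖im x‖` has no limit there in general. -/
theorem continuousOn_slice {E : Set ℂ} (hE : ∀ z ∈ E, star z ∈ E) {F : ℂ → A × A}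
    (hF : ContinuousOn F E) : ContinuousOn (slice F) (circ A E ∩ {x | ¬ IsReal x}) := by
  have h1 : ContinuousOn (fun x : A => F (toUpper x)) (circ A E ∩ {x | ¬ IsReal x}) :=
    hF.comp continuous_toUpper.continuousOn fun x hx => toUpper_mem hE hx.1
  have h2 : ContinuousOn (fun x : A => ‖im x‖⁻¹ • im x) (circ A E ∩ {x | ¬ IsReal x}) :=
    (continuous_im.norm.continuousOn.inv₀ fun x hx => by
      rw [norm_ne_zero_iff, Ne, ← isReal_iff]; exact hx.2).smul continuous_im.continuousOn
  exact (continuous_fst.comp_continuousOn h1).add (h2.mul (continuous_snd.comp_continuousOn h1))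

theorem sliceConj_ne_zero (hA : IsCHO A) {E : Set ℂ} {F : ℂ → A × A} (hF : IsStem E F)
    (hn : ∀ z ∈ E, nn (F z) ≠ 0) {x : A} (hx : x ∈ circ A E) : sliceConj F x ≠ 0 := by
  obtain ⟨z, hz, J, hJ, rfl⟩ := hx
  rw [sliceConj, slice_pt_eq_ev hA hF.conj hz hJ, stemConj_apply]
  exact ev_pconj_ne_zero (hn z hz) hJ

theorem Recip.continuousOn_T (hA : IsCHO A) {E : Set ℂ} {F G : ℂ → A × A} (R : Recip E F G)
    (hF : ContinuousOn F {z | z ∈ E ∧ (F z).2 ≠ 0}) :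
    ContinuousOn (T F) (support E (sphDerivZero F)) := by
  set E' : Set ℂ := {z | z ∈ E ∧ (F z).2 ≠ 0} with hE'
  have hE2 : ∀ z ∈ E', star z ∈ E' := fun z hz =>
    ⟨R.star_mem z hz.1, by rw [(R.left z hz.1).2, neg_ne_zero]; exact hz.2⟩
  have hstem : IsStem E' F := R.left.mono fun _ h => h.1
  have hsub : support E (sphDerivZero F) ⊆ circ A E' ∩ {x | ¬ IsReal x} := by
    intro x hx
    obtain ⟨J, hJ, h⟩ := exists_pt x
    refine ⟨?_, not_isReal_of_mem_support hx⟩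
    rw [h, pt_mem_support_iff hA R.star_mem R.left hJ] at hx
    exact ⟨_, hx, J, hJ, h⟩
  have hsup : ∀ x ∈ support E (sphDerivZero F), sphDeriv F x ≠ 0 := fun x hx => by
    have := hx.2
    rwa [sphDerivZero, if_neg (not_isReal_of_mem_support hx)] at this
  have hc : ContinuousOn (sliceConj F) (support E (sphDerivZero F)) :=
    (continuousOn_slice hE2 ((continuous_fst.comp_continuousOn hF).star.prodMk
      (continuous_snd.comp_continuousOn hF).star)).mono hsub
  have hd : ContinuousOn (sphDeriv F) (support E (sphDerivZero F)) := by
    have h1 : ContinuousOn (fun x : A => F (toUpper x)) (support E (sphDerivZero F)) :=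
      hF.comp continuous_toUpper.continuousOn fun x hx => toUpper_mem hE2 (hsub hx).1
    have h2 : ContinuousOn (fun x : A => ‖im x‖⁻¹ • (F (toUpper x)).2)
        (support E (sphDerivZero F)) :=
      (continuous_im.norm.continuousOn.inv₀ fun x hx => by
        rw [norm_ne_zero_iff, Ne, ← isReal_iff]; exact (hsub hx).2).smul
        (continuous_snd.comp_continuousOn h1)
    exact h2.congr fun x hx => sphDeriv_eq hA hE2 hstem (hsub hx).1
  have hc0 : ∀ x ∈ support E (sphDerivZero F), sliceConj F x ≠ 0 := fun x hx =>
    sliceConj_ne_zero hA R.left R.nn_ne hx.1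
  exact ((continuousOn_cinv hc hc0).mul ((continuousOn_id.mul hc).mul hd)).mul
    (continuousOn_cinv hd hsup)

theorem continuousOn_pinv {X : Type*} [TopologicalSpace X] {U : Set X} {F : X → A × A}
    (hF : ContinuousOn F U) (hn : ∀ x ∈ U, nn (F x) ≠ 0) :
    ContinuousOn (fun x => pinv (F x)) U := by
  have h1 := continuous_fst.comp_continuousOn hF
  have h2 := continuous_snd.comp_continuousOn hF
  have hnn : ContinuousOn (fun x => (nn (F x))⁻¹) U := by
    refine ContinuousOn.inv₀ ?_ hn
    exact Complex.equivRealProdCLM.symm.continuous.comp_continuousOn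
      (((h1.norm.pow 2).sub (h2.norm.pow 2)).prodMk (continuousOn_const.mul (h1.inner h2)))
  have hr := Complex.continuous_re.comp_continuousOn hnn
  have hi := Complex.continuous_im.comp_continuousOn hnn
  exact ((hr.smul h1.star).sub (hi.smul h2.star)).prodMk ((hr.smul h2.star).add (hi.smul h1.star))

theorem Recip.T_eqOn (F : ℂ → A × A) (E : Set ℂ) :
    Set.EqOn (transf F (sphDerivZero F)) (T F) (support E (sphDerivZero F)) :=
  fun _ hx => transf_sphDerivZero F (not_isReal_of_mem_support hx)

theorem Recip.invOn_T (hA : IsCHO A) {E : Set ℂ} {F G : ℂ → A × A} (R : Recip E F G) :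
    Set.InvOn (T G) (T F) (support E (sphDerivZero F)) (support E (sphDerivZero F)) := by
  have hs := isSphDeriv_sphDerivZero hA R.left
  have ht := isSphDeriv_sphDerivZero hA R.right
  have inv := R.invOn hA hs ht (R.support_eq hA)
  have mF := R.mapsTo hA hs
  have mG := R.symm.mapsTo hA ht
  rw [← R.support_eq hA] at mG
  have eF := Recip.T_eqOn F E
  have eG := Recip.T_eqOn G E
  rw [← R.support_eq hA] at eG
  constructor
  · intro x hx
    rw [← eF hx, ← eG (mF hx), inv.1 hx]
  · intro x hx
    rw [← eG hx, ← eF (mG hx), inv.2 hx]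

theorem Recip.isHomeoOn (hA : IsCHO A) {E : Set ℂ} {F G : ℂ → A × A} (R : Recip E F G)
    (hF : ContinuousOn F {z | z ∈ E ∧ (F z).2 ≠ 0}) :
    IsHomeoOn (T F) (support E (sphDerivZero F)) := by
  have hs := isSphDeriv_sphDerivZero hA R.left
  have ht := isSphDeriv_sphDerivZero hA R.right
  have mF := (R.mapsTo hA hs).congr (Recip.T_eqOn F E)
  have mG := (R.symm.mapsTo hA ht).congr (Recip.T_eqOn G E)
  have hG : ContinuousOn G {z | z ∈ E ∧ (G z).2 ≠ 0} := by
    have : {z | z ∈ E ∧ (G z).2 ≠ 0} = {z | z ∈ E ∧ (F z).2 ≠ 0} := by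
      ext z
      exact and_congr_right fun hz => not_congr (R.snd_eq_zero_iff hz)
    rw [this]
    exact (continuousOn_pinv hF fun z hz => R.nn_ne z hz.1).congr fun z hz => R.eq_pinv z hz.1
  have cF := R.continuousOn_T hA hF
  have cG := R.symm.continuousOn_T hA hG
  rw [← R.support_eq hA] at mG cG
  have inv := R.invOn_T hA
  exact ⟨{ toFun := mF.restrict
           invFun := mG.restrict
           left_inv := fun x => Subtype.ext (inv.1 x.2)
           right_inv := fun x => Subtype.ext (inv.2 x.2)
           continuous_toFun := cF.mapsToRestrict mF
           continuous_invFun := cG.mapsToRestrict mG }, fun _ => rfl⟩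

end Calculus

/-! ### Even and odd parts of analytic functions through resolvents -/

section Resolvent

set_option linter.unusedSectionVars false

open Filter Topology NNReal ENNReal

variable {E V : Type*} [NormedAddCommGroup E] [NormedSpace ℝ E] [NormedAddCommGroup V]
  [NormedSpace ℝ V]

/-- Bounded sequences of multilinear maps of increasing degree. -/
abbrev BddSeries (E V : Type*) [NormedAddCommGroup E] [NormedSpace ℝ E] [NormedAddCommGroup V]
    [NormedSpace ℝ V] : Type _ :=
  lp (fun n : ℕ => ContinuousMultilinearMap ℝ (fun _ : Fin n => E) V) ∞

theorem norm_curryLeft_apply_le (a : BddSeries E V) (y : E) (n : ℕ) :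
    ‖(a (n + 1)).curryLeft y‖ ≤ ‖y‖ * ‖a‖ := by
  refine ((a (n + 1)).curryLeft.le_opNorm y).trans ?_
  rw [ContinuousMultilinearMap.curryLeft_norm, mul_comm]
  exact mul_le_mul_of_nonneg_left (lp.norm_apply_le_norm ENNReal.top_ne_zero a (n + 1))
    (norm_nonneg y)

/-- The operator that inserts the vector `y` in the first slot of each map. -/
def insertVec (y : E) : BddSeries E V →L[ℝ] BddSeries E V :=
  LinearMap.mkContinuous
    { toFun := fun a => ⟨fun n => (a (n + 1)).curryLeft y, memℓp_infty ⟨‖y‖ * ‖a‖, by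
        rintro _ ⟨n, rfl⟩
        exact norm_curryLeft_apply_le a y n⟩⟩
      map_add' := fun a b => by ext n v; rfl
      map_smul' := fun r a => by ext n v; rfl }
    ‖y‖ fun a => lp.norm_le_of_forall_le (by positivity) fun n => norm_curryLeft_apply_le a y n

theorem insertVec_apply (y : E) (a : BddSeries E V) (n : ℕ) (v : Fin n → E) :
    insertVec y a n v = a (n + 1) (Fin.cons y v) := rfl

theorem norm_insertVec_le (y : E) : ‖(insertVec y : BddSeries E V →L[ℝ] BddSeries E V)‖ ≤ ‖y‖ :=
  LinearMap.mkContinuous_norm_le _ (norm_nonneg y) _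

theorem insertVec_linear (r s : ℝ) (x y : E) :
    (insertVec (r • x + s • y) : BddSeries E V →L[ℝ] BddSeries E V)
      = r • insertVec x + s • insertVec y := by
  ext a n v
  change a (n + 1) (Fin.cons (r • x + s • y) v)
    = r • a (n + 1) (Fin.cons x v) + s • a (n + 1) (Fin.cons y v)
  rw [ContinuousMultilinearMap.cons_add, ContinuousMultilinearMap.cons_smul,
    ContinuousMultilinearMap.cons_smul]

/-- Each application fills one slot with `y` and shifts the degree down; after `n` of them the
degree-zero entry is the `n`-th term of the power series. -/
theorem insertVec_pow_apply (y : E) (n : ℕ) (a : BddSeries E V) (v : Fin 0 → E) :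
    (insertVec y ^ n) a 0 v = a n fun _ => y := by
  induction n generalizing a with
  | zero => exact congrArg (a 0) (Subsingleton.elim _ _)
  | succ n ih =>
    rw [pow_succ, mul_apply_eq_comp, ih, insertVec_apply]
    congr 1
    ext i
    refine Fin.cases ?_ (fun j => ?_) i <;> simp

variable (E V) in
/-- The constant term of a series. -/
def constTerm : BddSeries E V →L[ℝ] V :=
  LinearMap.mkContinuous
    { toFun := fun a => a 0 0
      map_add' := fun a b => rfl
      map_smul' := fun r a => rfl } 1 fun a => by
    rw [one_mul]
    refine ((a 0).le_opNorm 0).trans ?_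
    simpa using lp.norm_apply_le_norm ENNReal.top_ne_zero a 0

variable [CompleteSpace V]

/-- The Neumann series of the resolvent, read in degree zero, is the power series with coefficients
`a`. -/
theorem constTerm_inverse {y : E} (hy : ‖y‖ < 1) (a : BddSeries E V) :
    HasSum (fun n => a n fun _ => y) (constTerm E V (Ring.inverse (1 - insertVec y) a)) := by
  have h1 : ‖(insertVec y : BddSeries E V →L[ℝ] BddSeries E V)‖ < 1 :=
    (norm_insertVec_le y).trans_lt hy
  have h2 := hasSum_geom_series_inverse (insertVec y : BddSeries E V →L[ℝ] BddSeries E V) h1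
  have h3 := ((constTerm E V).comp (ContinuousLinearMap.apply ℝ (BddSeries E V) a)).hasSum h2
  have h4 : (fun n => a n fun _ => y) = fun n => ((constTerm E V).comp
      (ContinuousLinearMap.apply ℝ (BddSeries E V) a)) (insertVec y ^ n) := by
    ext n
    exact (insertVec_pow_apply y n a 0).symm
  rw [h4]
  exact h3

/-- A germ of an analytic function is a matrix coefficient of the resolvent of a linear family of
operators. -/
theorem exists_resolvent {g : E → V} {x : E} (hg : AnalyticAt ℝ g x) :
    ∃ (r : ℝ) (a : BddSeries E V), ∀ᶠ y in 𝓝 (0 : E),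
      g (x + y) = constTerm E V (Ring.inverse (1 - insertVec (r • y)) a) := by
  obtain ⟨p, R, hp⟩ := hg
  obtain ⟨ρ, hρ0, hρ⟩ := ENNReal.lt_iff_exists_nnreal_btwn.1 (hp.r_pos.trans_le hp.r_le)
  have hρ0' : 0 < (ρ : ℝ) := by exact_mod_cast hρ0
  obtain ⟨C, -, hC⟩ := p.norm_mul_pow_le_of_lt_radius hρ
  -- Rescaling by a radius `ρ` below that of convergence makes the coefficients bounded; the
  -- argument is divided by `ρ` to compensate.
  refine ⟨(ρ : ℝ)⁻¹, ⟨fun n => (ρ : ℝ) ^ n • p n, memℓp_infty ⟨C, ?_⟩⟩, ?_⟩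
  · rintro _ ⟨n, rfl⟩
    simpa [norm_smul, mul_comm] using hC n
  have e1 : ∀ᶠ y in 𝓝 (0 : E), y ∈ Metric.eball (0 : E) R :=
    Metric.eball_mem_nhds 0 hp.r_pos
  have e2 : ∀ᶠ y in 𝓝 (0 : E), ‖(ρ : ℝ)⁻¹ • y‖ < 1 := by
    have : Tendsto (fun y : E => ‖(ρ : ℝ)⁻¹ • y‖) (𝓝 0) (𝓝 0) := by
      have h : Continuous fun y : E => ‖(ρ : ℝ)⁻¹ • y‖ := by fun_prop
      simpa using h.tendsto 0
    exact this.eventually_lt_const one_pos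
  filter_upwards [e1, e2] with y h1 h2
  refine (hp.hasSum h1).unique ?_
  have key : (fun n => p n fun _ => y) = fun n => (ρ : ℝ) ^ n • p n fun _ => (ρ : ℝ)⁻¹ • y := by
    ext n
    rw [ContinuousMultilinearMap.map_smul_univ, Finset.prod_const, Finset.card_univ,
      Fintype.card_fin, smul_smul, ← mul_pow, mul_inv_cancel₀ hρ0'.ne', one_pow, one_smul]
  rw [key]
  exact constTerm_inverse h2 _

/-- Factor `1 - U - βW = (1 - U)(1 - X)` with `X = βPW`, then invert `1 - X` as `(1 + X)(1 - X²)⁻¹`.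
Only `β²` enters `Q`, so the even and odd parts become visible. -/
theorem inverse_one_sub_add {B : Type*} [Ring B] [Algebra ℝ B] {U W P : B} {β : ℝ} {Q : B}
    (hP : (1 - U) * P = 1) (hQ : (1 - β ^ 2 • (P * W) ^ 2) * Q = 1)
    (hu : IsUnit (1 - (U + β • W))) :
    Ring.inverse (1 - (U + β • W)) = Q * P + β • (P * W * Q * P) := by
  have h1 : (1 - U) * (1 - β • (P * W)) = 1 - (U + β • W) := by
    have : (1 - U) * (P * W) = W := by rw [← mul_assoc, hP, one_mul]
    rw [mul_sub, mul_smul_comm, this, mul_one]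
    abel
  have h2 : (1 - β • (P * W)) * (1 + β • (P * W)) = 1 - β ^ 2 • (P * W) ^ 2 := by
    rw [mul_add, mul_one, sub_mul, one_mul, smul_mul_smul_comm, ← sq, ← sq]
    abel
  have h3 : (1 - (U + β • W)) * (Q * P + β • (P * W * Q * P)) = 1 := by
    have : Q * P + β • (P * W * Q * P) = (1 + β • (P * W)) * (Q * P) := by
      rw [add_mul, one_mul, smul_mul_assoc, ← mul_assoc (P * W)]
    rw [this, ← h1, mul_assoc, ← mul_assoc (1 - β • (P * W)), h2, ← mul_assoc _ Q, hQ, one_mul, hP]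
  calc _ = Ring.inverse (1 - (U + β • W)) * ((1 - (U + β • W)) * (Q * P + β • (P * W * Q * P))) := by
        rw [h3, mul_one]
    _ = _ := by rw [← mul_assoc, Ring.inverse_mul_cancel _ hu, one_mul]

theorem exists_even_odd_of_resolvent {B : Type*} [NormedRing B] [NormedAlgebra ℝ B]
    [CompleteSpace B] (U W : B) (ψ : B →L[ℝ] V) {g : ℝ × ℝ → V} {x₀ : ℝ}
    (h : ∀ᶠ y in 𝓝 (0 : ℝ × ℝ), g ((x₀, 0) + y) = ψ (Ring.inverse (1 - (y.1 • U + y.2 • W)))) :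
    ∃ K₀ K₁ : ℝ × ℝ → V, AnalyticAt ℝ K₀ (x₀, 0) ∧ AnalyticAt ℝ K₁ (x₀, 0) ∧
      ∀ᶠ y in 𝓝 (x₀, (0 : ℝ)), g y = K₀ (y.1, y.2 ^ 2) + y.2 • K₁ (y.1, y.2 ^ 2) := by
  set P : ℝ × ℝ → B := fun y => Ring.inverse (1 - (y.1 - x₀) • U) with hP
  -- The second variable stands for `β²`, so `Q` is later evaluated at `(α, β²)`.
  set Q : ℝ × ℝ → B := fun y => Ring.inverse (1 - y.2 • (P y * W) ^ 2) with hQ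
  have aux1 : AnalyticAt ℝ (fun y : ℝ × ℝ => (1 : B) - (y.1 - x₀) • U) (x₀, 0) :=
    analyticAt_const.sub ((analyticAt_fst.sub analyticAt_const).smul analyticAt_const)
  have aP : AnalyticAt ℝ P (x₀, 0) := by
    refine AnalyticAt.comp (g := Ring.inverse) ?_ aux1
    have := analyticAt_inverse (𝕜 := ℝ) (1 : Bˣ)
    simpa using this
  have aux2 : AnalyticAt ℝ (fun y : ℝ × ℝ => (1 : B) - y.2 • (P y * W) ^ 2) (x₀, 0) :=
    analyticAt_const.sub (analyticAt_snd.smul ((aP.mul analyticAt_const).pow 2))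
  have aQ : AnalyticAt ℝ Q (x₀, 0) := by
    refine AnalyticAt.comp (g := Ring.inverse) ?_ aux2
    have := analyticAt_inverse (𝕜 := ℝ) (1 : Bˣ)
    simpa using this
  refine ⟨fun y => ψ (Q y * P y), fun y => ψ (P y * W * Q y * P y),
    (ψ.analyticAt _).comp (aQ.mul aP),
    (ψ.analyticAt _).comp (((aP.mul analyticAt_const).mul aQ).mul aP), ?_⟩
  have isU : ∀ f : ℝ × ℝ → B, ContinuousAt f (x₀, 0) → f (x₀, 0) = 1 →
      ∀ᶠ y in 𝓝 (x₀, (0 : ℝ)), IsUnit (f y) := by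
    intro f hf h1
    refine hf.eventually ?_
    rw [h1]
    exact Units.nhds 1
  have u1 := isU _ aux1.continuousAt (by simp)
  have hsq : Tendsto (fun y : ℝ × ℝ => (y.1, y.2 ^ 2)) (𝓝 (x₀, 0)) (𝓝 (x₀, 0)) := by
    have : Continuous fun y : ℝ × ℝ => (y.1, y.2 ^ 2) := by fun_prop
    simpa using this.tendsto (x₀, (0 : ℝ))
  have u2 := hsq.eventually (isU _ aux2.continuousAt (by simp))
  have u3 := isU (fun y => 1 - ((y.1 - x₀) • U + y.2 • W)) (by fun_prop) (by simp)
  have hsub : Tendsto (fun y : ℝ × ℝ => y - (x₀, 0)) (𝓝 (x₀, 0)) (𝓝 0) := by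
    have : Continuous fun y : ℝ × ℝ => y - (x₀, 0) := by fun_prop
    simpa using this.tendsto (x₀, (0 : ℝ))
  filter_upwards [u1, u2, u3, hsub.eventually h] with y h1 h2 h3 h4
  rw [add_sub_cancel] at h4
  have h5 := inverse_one_sub_add (P := P y) (Q := Q (y.1, y.2 ^ 2)) (β := y.2)
    (Ring.mul_inverse_cancel _ h1) (Ring.mul_inverse_cancel _ h2) h3
  rw [h4]
  simp only [Prod.fst_sub, Prod.snd_sub, sub_zero]
  rw [h5, ← map_smul, ← map_add]

/-- An analytic function of `(α, β)` near `β = 0` has an even and an odd part that are analytic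
functions of `(α, β²)`. -/
theorem exists_even_odd {g : ℝ × ℝ → V} {x₀ : ℝ} (hg : AnalyticAt ℝ g (x₀, 0)) :
    ∃ K₀ K₁ : ℝ × ℝ → V, AnalyticAt ℝ K₀ (x₀, 0) ∧ AnalyticAt ℝ K₁ (x₀, 0) ∧
      ∀ᶠ y in 𝓝 (x₀, (0 : ℝ)), g y = K₀ (y.1, y.2 ^ 2) + y.2 • K₁ (y.1, y.2 ^ 2) := by
  obtain ⟨r, a, h⟩ := exists_resolvent hg
  set U : BddSeries (ℝ × ℝ) V →L[ℝ] BddSeries (ℝ × ℝ) V := insertVec (r, 0) with hU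
  set W : BddSeries (ℝ × ℝ) V →L[ℝ] BddSeries (ℝ × ℝ) V := insertVec (0, r) with hW
  have hlin (y : ℝ × ℝ) : insertVec (r • y) = y.1 • U + y.2 • W := by
    rw [hU, hW, ← insertVec_linear]
    congr 1
    ext <;> simp [mul_comm]
  simp only [hlin] at h
  let φ : (BddSeries (ℝ × ℝ) V →L[ℝ] BddSeries (ℝ × ℝ) V) →L[ℝ] V :=
    (constTerm (ℝ × ℝ) V).comp (ContinuousLinearMap.apply ℝ _ a)
  exact exists_even_odd_of_resolvent U W φ h

end Resolvent

/-! ### Analytic extension across the real line and slice regularity -/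

section Analytic

set_option linter.unusedSectionVars false

open Filter Topology

theorem eq_of_even {V : Type*} [NormedAddCommGroup V] [NormedSpace ℝ V] {g K₀ K₁ : ℝ × ℝ → V}
    {x₀ : ℝ} (h : ∀ᶠ y in 𝓝 (x₀, (0 : ℝ)), g y = K₀ (y.1, y.2 ^ 2) + y.2 • K₁ (y.1, y.2 ^ 2)) :
    ((∀ᶠ y in 𝓝 (x₀, (0 : ℝ)), g (y.1, -y.2) = g y) →
      ∀ᶠ y in 𝓝 (x₀, (0 : ℝ)), g y = K₀ (y.1, y.2 ^ 2)) ∧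
    ((∀ᶠ y in 𝓝 (x₀, (0 : ℝ)), g (y.1, -y.2) = -g y) →
      ∀ᶠ y in 𝓝 (x₀, (0 : ℝ)), g y = y.2 • K₁ (y.1, y.2 ^ 2)) := by
  have hneg : Tendsto (fun y : ℝ × ℝ => (y.1, -y.2)) (𝓝 (x₀, 0)) (𝓝 (x₀, 0)) := by
    have : Continuous fun y : ℝ × ℝ => (y.1, -y.2) := by fun_prop
    simpa using this.tendsto (x₀, (0 : ℝ))
  have h' := hneg.eventually h
  constructor
  · intro he
    filter_upwards [h, h', he] with y h1 h2 h3
    rw [h3] at h2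
    simp only [neg_sq, neg_smul] at h2
    linear_combination (norm := module) (1 / 2 : ℝ) • h1 + (1 / 2 : ℝ) • h2
  · intro he
    filter_upwards [h, h', he] with y h1 h2 h3
    rw [h3] at h2
    simp only [neg_sq, neg_smul] at h2
    linear_combination (norm := module) (1 / 2 : ℝ) • h1 - (1 / 2 : ℝ) • h2

variable {A : Type*} [NormedAddCommGroup A] [InnerProductSpace ℝ A] [Mul A] [One A] [Star A]
  [CompAlg A]

theorem isOpen_trace {U : Set A} (hU : IsOpen U) : IsOpen (trace U) := by
  have : trace U = ⋃ J ∈ imUnits A, (fun z : ℂ => pt z J) ⁻¹' U := by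
    ext z
    simp [trace]
  rw [this]
  refine isOpen_biUnion fun J _ => hU.preimage ?_
  exact (Complex.continuous_re.smul continuous_const).add
    (Complex.continuous_im.smul continuous_const)

/-- `F₁` is even in `β` and `F₂` is odd, so only the even part of the first and the odd part of the
second are kept. -/
theorem IsStem.exists_even_odd {E : Set ℂ} (hE : IsOpen E) {F : ℂ → A × A} (hF : IsStem E F)
    {x₀ : ℝ} (hx : (x₀ : ℂ) ∈ E) (ha : AnalyticAt ℝ F x₀) :
    ∃ K₀ K₁ : ℝ × ℝ → A, AnalyticAt ℝ K₀ (x₀, 0) ∧ AnalyticAt ℝ K₁ (x₀, 0) ∧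
      ∀ᶠ y in 𝓝 (x₀, (0 : ℝ)), (F ⟨y.1, y.2⟩).1 = K₀ (y.1, y.2 ^ 2) ∧
        (F ⟨y.1, y.2⟩).2 = y.2 • K₁ (y.1, y.2 ^ 2) := by
  have hc : AnalyticAt ℝ (fun y : ℝ × ℝ => F ⟨y.1, y.2⟩) (x₀, 0) :=
    AnalyticAt.comp (f := Complex.equivRealProdCLM.symm) (g := F) (by exact ha)
      (Complex.equivRealProdCLM.symm.toContinuousLinearMap.analyticAt _)
  have hE' : ∀ᶠ y in 𝓝 (x₀, (0 : ℝ)), (⟨y.1, y.2⟩ : ℂ) ∈ E :=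
    Complex.equivRealProdCLM.symm.continuous.continuousAt.eventually_mem (hE.mem_nhds hx)
  obtain ⟨K₀, _, h0, _, h⟩ := SliceFun.exists_even_odd (analyticAt_fst.comp hc)
  obtain ⟨_, K₁, _, h1, h'⟩ := SliceFun.exists_even_odd (analyticAt_snd.comp hc)
  refine ⟨K₀, K₁, h0, h1, ?_⟩
  refine ((eq_of_even h).1 ?_).and ((eq_of_even h').2 ?_)
  · filter_upwards [hE'] with y hy
    exact (hF _ hy).1
  · filter_upwards [hE'] with y hy
    exact (hF _ hy).2

theorem contDiff_re {n : WithTop ℕ∞} : ContDiff ℝ n (re : A → ℝ) := contDiff_id.inner ℝ contDiff_const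

theorem contDiff_im {n : WithTop ℕ∞} : ContDiff ℝ n (im : A → A) :=
  (contDiff_id.sub (starL' A).contDiff).const_smul _

theorem contDiffAt_toUpper {n : WithTop ℕ∞} {x : A} (hx : im x ≠ 0) :
    ContDiffAt ℝ n (toUpper : A → ℂ) x :=
  Complex.equivRealProdCLM.symm.contDiff.contDiffAt.comp x
    (contDiff_re.contDiffAt.prodMk (contDiff_im.contDiffAt.norm ℝ hx))

/-- The spherical derivative of `f = I(F)`, extended to the real line. -/
def sphExt (F : ℂ → A × A) (x : A) : A := open Classical in
  if IsReal x then deriv (fun β : ℝ => (F ⟨re x, β⟩).2) 0 else sphDeriv F x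

theorem analyticAt_of_nonreal (hA : IsCHO A) {E : Set ℂ} (hE : ∀ z ∈ E, star z ∈ E)
    (hU : IsOpen (circ A E)) {F : ℂ → A × A} (hF : IsStem E F) (ha : AnalyticOnNhd ℝ F E) {x : A}
    (hx : x ∈ circ A E) (hr : ¬ IsReal x) :
    AnalyticAt ℝ (slice F) x ∧ AnalyticAt ℝ (sphExt F) x := by
  have him : im x ≠ 0 := by rwa [Ne, ← isReal_iff]
  have h1 : ContDiffAt ℝ ω (fun x : A => F (toUpper x)) x :=
    (ha _ (toUpper_mem hE hx)).contDiffAt.comp x (contDiffAt_toUpper him)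
  have h2 : ContDiffAt ℝ ω (fun x : A => ‖im x‖⁻¹) x :=
    (contDiff_im.contDiffAt.norm ℝ him).inv (norm_ne_zero_iff.2 him)
  constructor
  · refine ContDiffAt.analyticAt ?_
    exact h1.fst.add (contDiffAt_mul (h2.smul contDiff_im.contDiffAt) h1.snd)
  · have h3 : ContDiffAt ℝ ω (fun x : A => ‖im x‖⁻¹ • (F (toUpper x)).2) x := h2.smul h1.snd
    refine h3.analyticAt.congr ?_
    have e1 : ∀ᶠ y in 𝓝 x, im y ≠ 0 := continuous_im.continuousAt.eventually_ne him
    filter_upwards [e1, hU.mem_nhds hx] with y h4 h5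
    rw [sphExt, if_neg (by rwa [isReal_iff]), sphDeriv_eq hA hE hF h5]

/-- With `q = (re, ‖im‖²)`, which is analytic, the slice function is `K₀ ∘ q + im · (K₁ ∘ q)` and
the extended spherical derivative is `K₁ ∘ q` near `x`: the norm of `im` enters only through its
square. -/
theorem analyticAt_of_real (hA : IsCHO A) {E : Set ℂ} (hE : ∀ z ∈ E, star z ∈ E)
    (hU : IsOpen (circ A E)) {F : ℂ → A × A} (hF : IsStem E F) (ha : AnalyticOnNhd ℝ F E) {x : A}
    (hx : x ∈ circ A E) (hr : IsReal x) :
    AnalyticAt ℝ (slice F) x ∧ AnalyticAt ℝ (sphExt F) x := by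
  have him : im x = 0 := isReal_iff.1 hr
  have hEo : IsOpen E := by
    rw [← trace_circ (A := A) hE]
    exact isOpen_trace hU
  have hup : toUpper x = (re x : ℂ) := by
    apply Complex.ext <;> simp [toUpper, him]
  have hx' : (re x : ℂ) ∈ E := by
    rw [← hup]
    exact toUpper_mem hE hx
  obtain ⟨K₀, K₁, h0, h1, h⟩ := hF.exists_even_odd hEo hx' (ha _ hx')
  set q : A → ℝ × ℝ := fun y => (re y, ‖im y‖ ^ 2) with hq
  have hqx : q x = (re x, 0) := by simp [hq, him]
  have hqa : AnalyticAt ℝ q x :=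
    (contDiff_re.contDiffAt.prodMk (contDiff_im.contDiffAt.norm_sq ℝ)).analyticAt
  rw [← hqx] at h0 h1
  have hK0 : AnalyticAt ℝ (fun y => K₀ (q y)) x := h0.comp hqa
  have hK1 : AnalyticAt ℝ (fun y => K₁ (q y)) x := h1.comp hqa
  have ht : Tendsto (fun y : A => (re y, ‖im y‖)) (𝓝 x) (𝓝 (re x, 0)) := by
    have : Continuous fun y : A => (re y, ‖im y‖) := continuous_re.prodMk continuous_im.norm
    simpa [him] using this.tendsto x
  constructor
  · have : AnalyticAt ℝ (fun y => K₀ (q y) + im y * K₁ (q y)) x := by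
      refine ContDiffAt.analyticAt ?_
      exact hK0.contDiffAt.add (contDiffAt_mul contDiff_im.contDiffAt hK1.contDiffAt)
    refine this.congr ?_
    filter_upwards [ht.eventually h] with y hy
    rw [slice, hy.1, hy.2]
    by_cases h0 : im y = 0
    · simp [h0, hq]
    · rw [smul_mul_assoc, mul_smul_comm, smul_smul, inv_mul_cancel₀ (norm_ne_zero_iff.2 h0),
        one_smul]
  · refine hK1.congr ?_
    have h1' : ∀ᶠ y in 𝓝 x, AnalyticAt ℝ K₁ (q y) :=
      hqa.continuousAt.eventually h1.eventually_analyticAt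
    -- At nearby real points the value is a derivative in `β`, so the local formula is needed on a
    -- whole neighbourhood of each of them; there `β K₁(α, β²)` has derivative `K₁(α, 0)` at `0`.
    filter_upwards [ht.eventually h, ht.eventually h.eventually_nhds, hU.mem_nhds hx, h1']
      with y hy hy' hyU hya
    by_cases h0 : im y = 0
    · rw [sphExt, if_pos (isReal_iff.2 h0)]
      rw [h0, norm_zero] at hy'
      have hqy : q y = (re y, (0 : ℝ) ^ 2) := by simp [hq, h0]
      have hd1 : HasDerivAt (fun β : ℝ => β • K₁ (re y, β ^ 2)) (K₁ (q y)) 0 := by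
        have hdd : DifferentiableAt ℝ (fun β : ℝ => K₁ (re y, β ^ 2)) 0 := by
          rw [hqy] at hya
          exact DifferentiableAt.comp (f := fun β : ℝ => (re y, β ^ 2)) (0 : ℝ)
            hya.differentiableAt (by fun_prop)
        have := (hasDerivAt_id' (0 : ℝ)).fun_smul hdd.hasDerivAt
        rw [zero_smul, zero_add, one_smul, ← hqy] at this
        exact this
      have hc : Tendsto (fun β : ℝ => (re y, β)) (𝓝 0) (𝓝 (re y, 0)) := by
        have : Continuous fun β : ℝ => (re y, β) := by fun_prop
        exact this.tendsto 0
      have hd2 : HasDerivAt (fun β : ℝ => (F ⟨re y, β⟩).2) (K₁ (q y)) 0 :=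
        hd1.congr_of_eventuallyEq ((hc.eventually hy').mono fun β hβ => hβ.2)
      exact hd2.deriv.symm
    · rw [sphExt, if_neg (by rwa [isReal_iff]), sphDeriv_eq hA hE hF hyU, toUpper, hy.2,
        smul_smul, inv_mul_cancel₀ (norm_ne_zero_iff.2 h0), one_smul]

theorem analyticOnNhd_slice (hA : IsCHO A) {E : Set ℂ} (hE : ∀ z ∈ E, star z ∈ E)
    (hU : IsOpen (circ A E)) {F : ℂ → A × A} (hF : IsStem E F) (ha : AnalyticOnNhd ℝ F E) :
    AnalyticOnNhd ℝ (slice F) (circ A E) ∧ AnalyticOnNhd ℝ (sphExt F) (circ A E) := by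
  have (x : A) (hx : x ∈ circ A E) : AnalyticAt ℝ (slice F) x ∧ AnalyticAt ℝ (sphExt F) x := by
    by_cases hr : IsReal x
    · exact analyticAt_of_real hA hE hU hF ha hx hr
    · exact analyticAt_of_nonreal hA hE hU hF ha hx hr
  exact ⟨fun x hx => (this x hx).1, fun x hx => (this x hx).2⟩

theorem isAnalyticExt_sphExt (hA : IsCHO A) {E : Set ℂ} (hE : ∀ z ∈ E, star z ∈ E)
    (hU : IsOpen (circ A E)) {F : ℂ → A × A} (hF : IsStem E F) (ha : AnalyticOnNhd ℝ F E) :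
    IsAnalyticExt (circ A E) F (sphExt F) :=
  ⟨(analyticOnNhd_slice hA hE hU hF ha).2, fun x _ hr => by rw [sphExt, if_neg hr]⟩

theorem IsAnalyticExt.isSphDeriv (hA : IsCHO A) {E : Set ℂ} {F : ℂ → A × A} (hF : IsStem E F)
    {h : A → A} (hh : IsAnalyticExt (circ A E) F h) : IsSphDeriv E F h := by
  intro z hz J hJ
  by_cases him : z.im = 0
  · rw [hF.snd_eq_zero hz him, him, zero_smul]
  · rw [hh.2 _ ⟨z, hz, J, hJ, rfl⟩ (by rwa [isReal_pt_iff hJ]), sphDeriv_pt hA hF hz hJ, smul_smul,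
      mul_inv_cancel₀ him, one_smul]

theorem contDiffAt_pinv {V : Type*} [NormedAddCommGroup V] [NormedSpace ℝ V] {n : WithTop ℕ∞}
    {F : V → A × A} {x : V} (hF : ContDiffAt ℝ n F x) (hn : nn (F x) ≠ 0) :
    ContDiffAt ℝ n (fun x => pinv (F x)) x := by
  have h1 := hF.fst
  have h2 := hF.snd
  have hnn : ContDiffAt ℝ n (fun x => (nn (F x))⁻¹) x := by
    refine ContDiffAt.inv ?_ hn
    exact Complex.equivRealProdCLM.symm.contDiff.contDiffAt.comp x
      (((h1.norm_sq ℝ).sub (h2.norm_sq ℝ)).prodMk (contDiffAt_const.mul (h1.inner ℝ h2)))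
  have hr : ContDiffAt ℝ n (fun x => ((nn (F x))⁻¹).re) x :=
    Complex.reCLM.contDiff.contDiffAt.comp x hnn
  have hi : ContDiffAt ℝ n (fun x => ((nn (F x))⁻¹).im) x :=
    Complex.imCLM.contDiff.contDiffAt.comp x hnn
  have h1 := contDiffAt_star h1
  have h2 := contDiffAt_star h2
  exact ((hr.smul h1).sub (hi.smul h2)).prodMk ((hr.smul h2).add (hi.smul h1))

theorem Recip.analyticOnNhd_right {E : Set ℂ} (hE : IsOpen E) {F G : ℂ → A × A} (R : Recip E F G)
    (ha : AnalyticOnNhd ℝ F E) : AnalyticOnNhd ℝ G E := by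
  intro z hz
  have := (contDiffAt_pinv (ha z hz).contDiffAt (R.nn_ne z hz)).analyticAt
  refine this.congr ?_
  filter_upwards [hE.mem_nhds hz] with w hw
  rw [R.eq_pinv w hw]

/-- A real point is the limit of the nonreal points `x + t J` as `t → 0`, `t ≠ 0`. -/
theorem eq_zero_of_real {U : Set A} (hU : IsOpen U) {φ : A → A} (hφ : ContinuousOn φ U)
    (h : ∀ x ∈ U, ¬ IsReal x → φ x = 0) {x : A} (hx : x ∈ U) : φ x = 0 := by
  by_cases hr : IsReal x
  · obtain ⟨J, hJ⟩ := exists_mem_imUnits A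
    have hc : Tendsto (fun t : ℝ => x + t • J) (𝓝 0) (𝓝 x) := by
      have : Continuous fun t : ℝ => x + t • J := by fun_prop
      simpa using this.tendsto 0
    have h1 : Tendsto (fun t : ℝ => φ (x + t • J)) (𝓝[≠] 0) (𝓝 (φ x)) :=
      ((hφ.continuousAt (hU.mem_nhds hx)).tendsto.comp hc).mono_left nhdsWithin_le_nhds
    have h2 : Tendsto (fun t : ℝ => φ (x + t • J)) (𝓝[≠] 0) (𝓝 0) := by
      refine tendsto_const_nhds.congr' ?_
      have e1 : ∀ᶠ t in 𝓝[≠] (0 : ℝ), x + t • J ∈ U :=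
        (hc.eventually (hU.mem_nhds hx)).filter_mono nhdsWithin_le_nhds
      filter_upwards [e1, self_mem_nhdsWithin] with t h3 h4
      refine (h _ h3 ?_).symm
      obtain ⟨r, rfl⟩ := hr
      have : r • (1 : A) + t • J = pt ⟨r, t⟩ J := rfl
      rw [this, isReal_pt_iff hJ]
      exact h4
    exact tendsto_nhds_unique h1 h2
  · exact h x hx hr

/-- The second component of `F G = 1`, divided by `β`, is `F₁ k + h G₁ = 0` off the real line, and
it persists on it by continuity. If `h x = 0` then `F₁ k = 0`, where `F₁ ≠ 0` because `F₂` vanishes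
too and `nn (F z) ≠ 0`. -/
theorem Recip.ext_eq_zero (hA : IsCHO A) {E : Set ℂ} (hU : IsOpen (circ A E)) {F G : ℂ → A × A}
    (R : Recip E F G) (hcF : ContinuousOn F E) (hcG : ContinuousOn G E) {h k : A → A}
    (hh : IsAnalyticExt (circ A E) F h) (hk : IsAnalyticExt (circ A E) G k) {x : A}
    (hx : x ∈ circ A E) (h0 : h x = 0) : k x = 0 := by
  have hm : Set.MapsTo toUpper (circ A E) E := fun x hx => toUpper_mem R.star_mem hx
  have c1 : ContinuousOn (fun y : A => F (toUpper y)) (circ A E) :=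
    hcF.comp continuous_toUpper.continuousOn hm
  have c2 : ContinuousOn (fun y : A => G (toUpper y)) (circ A E) :=
    hcG.comp continuous_toUpper.continuousOn hm
  have c3 : ContinuousOn (fun y : A => (F (toUpper y)).1 * k y + h y * (G (toUpper y)).1)
      (circ A E) :=
    ((continuous_fst.comp_continuousOn c1).mul hk.1.continuousOn).add
      (hh.1.continuousOn.mul (continuous_fst.comp_continuousOn c2))
  have key := eq_zero_of_real hU c3 (fun y hy hr => by
    have h1 := congrArg Prod.snd (R.pmul_eq (hm hy))
    rw [hh.2 y hy hr, hk.2 y hy hr, sphDeriv_eq hA R.star_mem R.left hy,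
      sphDeriv_eq hA R.star_mem R.right hy, mul_smul_comm, smul_mul_assoc, ← smul_add]
    simp only [pmul] at h1
    rw [h1, smul_zero]) hx
  rw [h0, zero_mul, add_zero] at key
  rcases mul_eq_zero.1 key with h2 | h2
  · have hF2 : (F (toUpper x)).2 = 0 := by
      obtain ⟨J, hJ, hxJ⟩ := exists_pt x
      have := hh.isSphDeriv hA R.left _ (hm hx) J hJ
      rw [toUpper, ← hxJ, h0, smul_zero] at this
      exact this
    refine absurd ?_ (R.nn_ne _ (hm hx))
    simp [nn, h2, hF2]
    rfl
  · exact h2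

theorem Recip.support_ext_eq (hA : IsCHO A) {E : Set ℂ} (hU : IsOpen (circ A E))
    {F G : ℂ → A × A} (R : Recip E F G) (hcF : ContinuousOn F E) (hcG : ContinuousOn G E)
    {h k : A → A} (hh : IsAnalyticExt (circ A E) F h) (hk : IsAnalyticExt (circ A E) G k) :
    support E h = support E k := by
  ext x
  exact and_congr_right fun hx => not_congr
    ⟨R.ext_eq_zero hA hU hcF hcG hh hk hx, R.symm.ext_eq_zero hA hU hcG hcF hk hh hx⟩

theorem Recip.analyticOnNhd_transf (hA : IsCHO A) {E : Set ℂ} (hU : IsOpen (circ A E))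
    {F G : ℂ → A × A} (R : Recip E F G) (ha : AnalyticOnNhd ℝ F E) {h : A → A}
    (hh : IsAnalyticExt (circ A E) F h) : AnalyticOnNhd ℝ (transf F h) (support E h) := by
  intro x hx
  have hconj : AnalyticOnNhd ℝ (stemConj F) E := fun z hz =>
    (((contDiffAt_star (ha z hz).contDiffAt.fst)).prodMk
      (contDiffAt_star (ha z hz).contDiffAt.snd) : ContDiffAt ℝ ω _ z).analyticAt
  have h1 : ContDiffAt ℝ ω (sliceConj F) x :=
    ((analyticOnNhd_slice hA R.star_mem hU R.left.conj hconj).1 x hx.1).contDiffAt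
  have h2 : ContDiffAt ℝ ω h x := (hh.1 x hx.1).contDiffAt
  refine ContDiffAt.analyticAt ?_
  exact contDiffAt_mul (contDiffAt_mul (contDiffAt_cinv h1
      (sliceConj_ne_zero hA R.left R.nn_ne hx.1)) (contDiffAt_mul (contDiffAt_mul contDiffAt_id h1)
      h2)) (contDiffAt_cinv h2 hx.2)

/-- A slice regular stem function is real analytic. -/
theorem IsSliceRegular.analyticOnNhd {E : Set ℂ} (hE : IsOpen E) {F : ℂ → A × A}
    (hF : IsSliceRegular E F) : AnalyticOnNhd ℝ F E := by
  set b := stdOrthonormalBasis ℝ A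
  -- In an orthonormal basis of `A`, a pair in `A ⊗ ℂ` becomes a vector of complex coordinates. The
  -- Cauchy-Riemann equations make each one holomorphic, hence analytic, and `F` is rebuilt from
  -- their real and imaginary parts.
  set c : Fin (Module.finrank ℝ A) → ℂ → ℂ := fun i z =>
    ⟨inner ℝ (b i) (F z).1, inner ℝ (b i) (F z).2⟩ with hc
  have hd : ∀ i, AnalyticOnNhd ℂ (c i) E := by
    intro i
    refine DifferentiableOn.analyticOnNhd (fun z hz => ?_) hE
    refine DifferentiableAt.differentiableWithinAt ?_
    have hFz : HasFDerivAt F (fderiv ℝ F z) z :=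
      ((hF.1.differentiableOn one_ne_zero).differentiableAt (hE.mem_nhds hz)).hasFDerivAt
    let M : A × A →L[ℝ] ℂ := Complex.equivRealProdCLM.symm.toContinuousLinearMap.comp
      (((innerSL ℝ (b i)).comp (ContinuousLinearMap.fst ℝ A A)).prod
        ((innerSL ℝ (b i)).comp (ContinuousLinearMap.snd ℝ A A)))
    have hcz : HasFDerivAt (c i) (M.comp (fderiv ℝ F z)) z := M.hasFDerivAt.comp z hFz
    obtain ⟨h1, h2⟩ := hF.2 z hz
    rw [differentiableAt_complex_iff_differentiableAt_real]
    refine ⟨hcz.differentiableAt, ?_⟩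
    rw [hcz.fderiv]
    change (⟨inner ℝ (b i) (fderiv ℝ F z Complex.I).1, inner ℝ (b i) (fderiv ℝ F z Complex.I).2⟩ : ℂ)
      = Complex.I • (⟨inner ℝ (b i) (fderiv ℝ F z 1).1, inner ℝ (b i) (fderiv ℝ F z 1).2⟩ : ℂ)
    rw [h1, h2]
    apply Complex.ext <;> simp
  intro z hz
  have hre (i) : AnalyticAt ℝ (fun z => (c i z).re) z :=
    (Complex.reCLM.analyticAt _).comp ((hd i z hz).restrictScalars)
  have him (i) : AnalyticAt ℝ (fun z => (c i z).im) z :=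
    (Complex.imCLM.analyticAt _).comp ((hd i z hz).restrictScalars)
  have h1 : AnalyticAt ℝ (fun z => ∑ i, (c i z).re • b i) z :=
    Finset.analyticAt_fun_sum _ fun i _ => (hre i).smul analyticAt_const
  have h2 : AnalyticAt ℝ (fun z => ∑ i, (c i z).im • b i) z :=
    Finset.analyticAt_fun_sum _ fun i _ => (him i).smul analyticAt_const
  refine (h1.prod h2).congr (Eventually.of_forall fun w => ?_)
  exact Prod.ext (b.sum_repr' (F w).1) (b.sum_repr' (F w).2)

end Analytic

end SliceFun

end

/-! ### The main theorem -/

open SliceFun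
theorem mainTheorem4 {A : Type*} [NormedAddCommGroup A] [InnerProductSpace ℝ A]
    [Mul A] [One A] [Star A] (hA : IsCHO A)
    (D : Set ℂ) (hD : ∀ z ∈ D, star z ∈ D)
    (F : ℂ → A × A) (hF : IsStem D F)
    (hne : (Omega1 D F).Nonempty) :
    -- the reciprocal exists and is unique as a slice function on `Ω'`
    (∃ G, IsReciprocal (trace (Omega1 D F)) F G ∧
      ∀ G', IsReciprocal (trace (Omega1 D F)) F G' →
        Set.EqOn G' G (trace (Omega1 D F))) ∧
    -- `SR(Ω') ⊆ S^ω(Ω')`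
    (IsOpen (Omega1 D F) → ∀ H : ℂ → A × A, IsStem (trace (Omega1 D F)) H →
      IsSliceRegular (trace (Omega1 D F)) H → AnalyticOnNhd ℝ H (trace (Omega1 D F))) ∧
    -- `g = I(G)` is the reciprocal of `f = I(F)`
    ∀ G, IsReciprocal (trace (Omega1 D F)) F G →
      (∀ x ∈ Omega1 D F, (IsReal x ∨ sphDeriv F x = 0) →
        slice G x = cinv (slice F x) ∧ ∀ y ∈ sph x, slice G x = cinv (slice F y)) ∧
      (∀ x ∈ Omega2 D F, slice G x = cinv (slice F (T F x))) ∧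
      Set.BijOn (T F) (Omega2 D F) (Omega2 D F) ∧
      (∀ y ∈ Omega2 D F, IsConformalOnSph (T F) y) ∧
      (ContinuousOn F (trace (Omega2 D F)) → IsHomeoOn (T F) (Omega2 D F)) ∧
      -- `T_g` has the same domain as `T_f` and is its inverse
      Omega2 (trace (Omega1 D F)) G = Omega2 D F ∧
      Set.InvOn (T G) (T F) (Omega2 D F) (Omega2 D F) ∧
      -- the real analytic case
      (IsOpen (Omega1 D F) → AnalyticOnNhd ℝ F (trace (Omega1 D F)) →
        (∃ h, IsAnalyticExt (Omega1 D F) F h) ∧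
        (∃ k, IsAnalyticExt (Omega1 D F) G k) ∧
        ∀ h, IsAnalyticExt (Omega1 D F) F h →
          IsAnalyticDiffeoOn (transf F h) {x | x ∈ Omega1 D F ∧ h x ≠ 0} ∧
          (∀ x ∈ Omega1 D F, h x ≠ 0 → slice G x = cinv (slice F (transf F h x))) ∧
          ∀ k, IsAnalyticExt (Omega1 D F) G k →
            {x | x ∈ Omega1 D F ∧ k x ≠ 0} = {x | x ∈ Omega1 D F ∧ h x ≠ 0} ∧
            Set.InvOn (transf G k) (transf F h)
              {x | x ∈ Omega1 D F ∧ h x ≠ 0} {x | x ∈ Omega1 D F ∧ h x ≠ 0}) := by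
  have := hA.compAlg
  have hE := star_mem_regularSet hD hF
  have hFE : IsStem (regularSet D F) F := hF.mono (regularSet_subset D F)
  have hn : ∀ z ∈ regularSet D F, nn (F z) ≠ 0 := fun z hz => hz.2
  rw [trace_omega1 hA hD hF]
  refine ⟨⟨fun z => pinv (F z), (isReciprocal_iff hA hE hFE hn).2 (recip_pinv hE hFE hn), ?_⟩,
    ?_, ?_⟩
  · intro G' hG' z hz
    exact ((isReciprocal_iff hA hE hFE hn).1 hG').eq_pinv z hz
  · intro hU H _ hH
    refine hH.analyticOnNhd ?_
    rw [← trace_omega1 hA hD hF]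
    exact isOpen_trace hU
  intro G hG
  have R := (isReciprocal_iff hA hE hFE hn).1 hG
  have hs := isSphDeriv_sphDerivZero hA hFE
  have h2 : Omega2 D F = support (regularSet D F) (sphDerivZero F) := omega2_eq_support hA hF
  -- The normal function of the reciprocal has no zeros on `Ω'`, so forming `Ω''` from `g` removes
  -- nothing more at this stage.
  have hregG : regularSet (regularSet D F) G = regularSet D F :=
    Set.Subset.antisymm (regularSet_subset _ _) fun z hz => ⟨hz, R.nn_right_ne hz⟩
  have h2G : Omega2 (regularSet D F) G = Omega2 D F := by
    rw [omega2_eq_support hA R.right, hregG, h2, R.support_eq hA]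
  have htr : trace (Omega2 D F) = {z | z ∈ regularSet D F ∧ (F z).2 ≠ 0} := by
    ext z
    rw [h2]
    constructor
    · rintro ⟨J, hJ, h⟩
      exact (pt_mem_support_iff hA hE hFE hJ).1 h
    · intro h
      obtain ⟨J, hJ⟩ := exists_mem_imUnits A
      exact ⟨J, hJ, (pt_mem_support_iff hA hE hFE hJ).2 h⟩
  have hinv := R.invOn_T hA
  rw [h2G, htr, h2]
  refine ⟨?_, ?_, ?_, fun y hy => R.isConformalOnSph hA hy, R.isHomeoOn hA, rfl, hinv, ?_⟩
  · rw [omega1_eq hA hF]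
    rintro x ⟨z, hz, J, hJ, rfl⟩ h
    -- Both alternatives, real point or vanishing spherical derivative, mean that `F₂` vanishes; `f`
    -- and `g` are then constant on the sphere.
    have hF2 : (F z).2 = 0 := by
      by_cases him : z.im = 0
      · exact hFE.snd_eq_zero hz him
      · rw [isReal_pt_iff hJ, sphDeriv_pt hA hF hz.1 hJ] at h
        simpa [him] using h
    have key : ∀ y ∈ sph (pt z J), slice G (pt z J) = cinv (slice F y) := by
      rw [sph_pt hJ]
      rintro y ⟨K, hK, rfl⟩
      rw [slice_pt_eq_ev hA R.right hz hJ, slice_pt_eq_ev hA hFE hz hK, ev, ev,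
        R.snd_eq_zero_of hz hF2, hF2, mul_zero, mul_zero, add_zero, add_zero,
        R.fst_eq_cinv hz hF2]
    refine ⟨key _ ?_, key⟩
    rw [sph_pt hJ]
    exact ⟨J, hJ, rfl⟩
  · intro x hx
    rw [← Recip.T_eqOn F _ hx]
    exact R.slice_eq hA hs hx
  · exact (R.bijOn hA hs (isSphDeriv_sphDerivZero hA R.right) (R.support_eq hA)).congr
      (Recip.T_eqOn F _)
  · rw [omega1_eq hA hF]
    intro hU ha
    have hEo : IsOpen (regularSet D F) := by
      rw [← trace_circ (A := A) hE]
      exact isOpen_trace hU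
    have haG := R.analyticOnNhd_right hEo ha
    have hk := isAnalyticExt_sphExt hA hE hU R.right haG
    refine ⟨⟨_, isAnalyticExt_sphExt hA hE hU hFE ha⟩, ⟨_, hk⟩, fun h hh => ?_⟩
    have hsh := hh.isSphDeriv hA hFE
    have hst {k : A → A} (hk : IsAnalyticExt (circ A (regularSet D F)) G k) :=
      R.support_ext_eq hA hU ha.continuousOn haG.continuousOn hh hk
    have inv {k : A → A} (hk : IsAnalyticExt (circ A (regularSet D F)) G k) :=
      R.invOn hA hsh (hk.isSphDeriv hA R.right) (hst hk)
    -- The analytic inverse is the transformation of `g` built from the extension `sphExt G`; its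
    -- domain is identified with that of `f` by `hst`.
    refine ⟨⟨R.bijOn hA hsh (hk.isSphDeriv hA R.right) (hst hk),
      R.analyticOnNhd_transf hA hU ha hh, _, inv hk, ?_⟩, fun x hx h0 => R.slice_eq hA hsh ⟨hx, h0⟩,
      fun k hk => ⟨(hst hk).symm, inv hk⟩⟩
    have := R.symm.analyticOnNhd_transf hA hU haG hk
    rwa [← hst hk] at this
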